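/- A quandle is a set $Q$ with a binary operation $\rhd$ such that every left multiplication $y\mapsto x\rhd y$ is an automorphism of $(Q,\rhd)$ and $x\rhd x=x$ for all $x$; it is involutory if $x\rhd(x\rhd y)=y$ for all $x,y$. A pro-finite involutory quandle is an involutory quandle with a totally disconnected compact Hausdorff topology for which $\rhd$ is continuous. For a topological group $G$ let $\mathrm{Inv}(G)=\{s\in G: s^2=1\neq s\}$ be the involutory quandle of involutions, with the operation $g\rhd x=gxg^{-1}$ and the subspace topology. The Artin--Schreier quandle of a field $F$ is $\mathrm{AS}(F)=\mathrm{Inv}(\mathrm{Gal}(F))$, where $\mathrm{Gal}(F)$ is the absolute Galois group of $F$ with its Krull topology. Let $\mathrm{F}^{\wedge}_2\{\sigma,\tau\}$ be the pro-finite completion of the group $\langle\sigma,\tau\mid\sigma^2=\tau^2=1\rangle$, and let $\mathrm{FQ}^{\wedge}_2\{\sigma,\tau\}=\mathrm{Inv}(\mathrm{F}^{\wedge}_2\{\sigma,\tau\})$, which contains (the images of) $\sigma$ and $\tau$. Products of quandles carry the componentwise operation and the product topology. Theorem. For any field $F$ there is an isomorphism of involutory quandles \[ \mathrm{AS}(F(\!(t)\!))\;\cong\;\mathrm{AS}(F)\times\mathrm{FQ}^{\wedge}_2\{\sigma,\tau\}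 \] that is also a homeomorphism. Here $\mathrm{FQ}^{\wedge}_2\{\sigma,\tau\}$ is the free pro-finite involutory quandle on the two elements $\sigma,\tau$: it is a pro-finite involutory quandle, and every map from $\{\sigma,\tau\}$ to a pro-finite involutory quandle $Q$ extends uniquely to a continuous morphism of quandles $\mathrm{FQ}^{\wedge}_2\{\sigma,\tau\}\to Q$. Moreover, $\mathrm{FQ}^{\wedge}_2\{\sigma,\tau\}$ is isomorphic, as a topological quandle, to the pro-finite integers $\widehat{\mathbb{Z}}=\varprojlim_n\mathbb{Z}/n$ with the operation $a\rhd b=2a-b$. -/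

import Mathlib

open scoped Quandles LaurentSeries

universe u v w

namespace ArtinSchreier

/-- The product of two quandles, with the componentwise operation. -/
instance prodQuandle (A : Type u) (B : Type v) [Quandle A] [Quandle B] : Quandle (A × B) where
  act x y := (x.1 ◃ y.1, x.2 ◃ y.2)
  self_distrib := by
    intro x y z
    exact Prod.ext Shelf.self_distrib Shelf.self_distrib
  invAct x y := (x.1 ◃⁻¹ y.1, x.2 ◃⁻¹ y.2)
  left_inv x y := Prod.ext (Rack.left_inv x.1 y.1) (Rack.left_inv x.2 y.2)
  right_inv x y := Prod.ext (Rack.right_inv x.1 y.1) (Rack.right_inv x.2 y.2)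
  fix := Prod.ext Quandle.fix Quandle.fix

/-- The involutions of a group: the elements of order exactly two (so not the identity).
For a topological group, this carries the subspace topology. -/
abbrev Involutions (G : Type u) [Group G] : Type u := {s : G // s ^ 2 = 1 ∧ s ≠ 1}

theorem conj_isInvolution {G : Type u} [Group G] (g : G) {s : G} (hs : s ^ 2 = 1 ∧ s ≠ 1) :
    (g * s * g⁻¹) ^ 2 = 1 ∧ g * s * g⁻¹ ≠ 1 := by
  refine ⟨?_, fun h => hs.2 ?_⟩
  · rw [conj_pow, hs.1]; simp
  · exact conj_eq_one_iff.mp h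

/-- The involutions of a group form a quandle under conjugation `g ▷ x = g x g⁻¹`. -/
instance involutionsQuandle (G : Type u) [Group G] : Quandle (Involutions G) where
  act g x := ⟨g.1 * x.1 * g.1⁻¹, conj_isInvolution g.1 x.2⟩
  self_distrib := by
    intro x y z
    apply Subtype.ext
    simp only
    group
  invAct g x := ⟨g.1⁻¹ * x.1 * g.1, by simpa using conj_isInvolution g.1⁻¹ x.2⟩
  left_inv g x := by
    apply Subtype.ext
    simp only
    group
  right_inv g x := by
    apply Subtype.ext
    simp only
    group
  fix := by
    intro x
    apply Subtype.ext
    simp only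
    group

theorem involutions_isInvolutory (G : Type u) [Group G] : Rack.IsInvolutory (Involutions G) := by
  intro g x
  apply Subtype.ext
  have h1 : g.1 * g.1 = 1 := by rw [← pow_two]; exact g.2.1
  have h2 : g.1⁻¹ = g.1 := inv_eq_of_mul_eq_one_right h1
  change g.1 * (g.1 * x.1 * g.1⁻¹) * g.1⁻¹ = x.1
  rw [h2]
  calc g.1 * (g.1 * x.1 * g.1) * g.1 = (g.1 * g.1) * x.1 * (g.1 * g.1) := by group
    _ = x.1 := by rw [h1]; simp

/-- The Artin–Schreier quandle of a field: the involutions in its absolute Galois group, under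
conjugation, with the topology inherited from the Krull topology. -/
abbrev AS (F : Type u) [Field F] : Type u := Involutions (Field.absoluteGaloisGroup F)

/-- An isomorphism of topological quandles: a homeomorphism that preserves the operation. -/
structure QuandleHomeo (A : Type u) (B : Type v) [Quandle A] [Quandle B]
    [TopologicalSpace A] [TopologicalSpace B] extends A ≃ₜ B where
  map_act' : ∀ x y : A, toFun (x ◃ y) = toFun x ◃ toFun y

/-- A pro-finite involutory quandle: an involutory quandle with a totally disconnected compact
Hausdorff topology for which the operation is continuous. -/
structure IsProfiniteInvolutory (Q : Type u) [Quandle Q] [TopologicalSpace Q] : Prop where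
  involutory : Rack.IsInvolutory Q
  continuous_act : Continuous fun p : Q × Q => p.1 ◃ p.2
  compact : CompactSpace Q
  hausdorff : T2Space Q
  totallyDisconnected : TotallyDisconnectedSpace Q

/-- `ι : S → Q` exhibits `Q` as the free pro-finite involutory quandle on the space `S`: every
continuous map from `S` to a pro-finite involutory quandle (in the universe `v`) extends uniquely
along `ι` to a continuous morphism of quandles. -/
structure IsFreeProfiniteInvolutory {S : Type w} {Q : Type u} [TopologicalSpace S]
    [Quandle Q] [TopologicalSpace Q] (ι : S → Q) : Prop where
  profinite : IsProfiniteInvolutory Q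
  continuous_ι : Continuous ι
  existsUnique_lift : ∀ (R : Type v) [Quandle R] [TopologicalSpace R], IsProfiniteInvolutory R →
    ∀ f : S → R, Continuous f → ∃! g : Q →◃ R, Continuous g ∧ ∀ s, g (ι s) = f s

/-- The universal Coxeter group on `S`, `⟨ s ∈ S | s² = 1 for all s ∈ S ⟩`. -/
abbrev F2 (S : Type u) : Type u := PresentedGroup (Set.range fun s : S => FreeGroup.of s ^ 2)

/-- For a finite set `S`, the pro-finite universal Coxeter group on `S`: the pro-finite completion
of the universal Coxeter group, i.e. the limit of its finite quotients. -/
noncomputable abbrev F2hat (S : Type u) : ProfiniteGrp.{u} :=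
  ProfiniteGrp.ProfiniteCompletion.completion (GrpCat.of (F2 S))

/-- For a finite set `S`, the pro-finite involutory quandle of involutions in the pro-finite
universal Coxeter group on `S`. -/
abbrev FQ2hat (S : Type u) : Type u := Involutions (F2hat S)

/-- The image of a generator in the pro-finite universal Coxeter group. -/
noncomputable def F2hat.of {S : Type u} (s : S) : F2hat S :=
  ProfiniteGrp.ProfiniteCompletion.etaFn (GrpCat.of (F2 S)) (PresentedGroup.of s)

/-- The homomorphism from the universal Coxeter group to the group of order two that maps every
generator to the non-trivial element. -/
def F2.sign (S : Type u) : F2 S →* Multiplicative (ZMod 2) :=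
  PresentedGroup.toGroup (f := fun _ : S => Multiplicative.ofAdd (1 : ZMod 2)) (by
    rintro _ ⟨s, rfl⟩
    rw [map_pow, FreeGroup.lift_apply_of]
    decide)

theorem F2hat.of_isInvolution {S : Type u} (s : S) :
    F2hat.of s ^ 2 = 1 ∧ F2hat.of s ≠ 1 := by
  constructor
  · have h : (PresentedGroup.of s : F2 S) ^ 2 = 1 := by
      have := PresentedGroup.one_of_mem (rels := Set.range fun s : S => FreeGroup.of s ^ 2)
        (Set.mem_range_self s)
      simpa using! this
    have h2 := map_pow (ProfiniteGrp.ProfiniteCompletion.eta (GrpCat.of (F2 S))).hom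
      (PresentedGroup.of s : F2 S) 2
    rw [h, map_one] at h2
    exact h2.symm
  · intro h
    have : (F2.sign S).ker.FiniteIndex := inferInstance
    let N : FiniteIndexNormalSubgroup (F2 S) := { toSubgroup := (F2.sign S).ker }
    have h1 : (QuotientGroup.mk (PresentedGroup.of s) : F2 S ⧸ N.toSubgroup) = 1 :=
      congrFun (congrArg Subtype.val h) N
    rw [QuotientGroup.eq_one_iff] at h1
    have h2 : F2.sign S (PresentedGroup.of s) = 1 := h1
    rw [F2.sign, PresentedGroup.toGroup.of] at h2
    exact absurd h2 (by decide)

/-- The canonical map from `S` to the quandle of involutions in the pro-finite universal Coxeter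
group on `S`. -/
noncomputable def FQ2hat.of {S : Type u} (s : S) : FQ2hat S := ⟨F2hat.of s, F2hat.of_isInvolution s⟩

/-- The ring of pro-finite integers: compatible families of residue classes modulo all positive
integers, inside the product of the (discrete) rings `ℤ/n`. -/
def zhatSubring : Subring (∀ n : ℕ+, ZMod n) where
  carrier := {a | ∀ (m n : ℕ+) (h : (m : ℕ) ∣ n), ZMod.castHom h (ZMod m) (a n) = a m}
  mul_mem' ha hb m n h := by simp only [Pi.mul_apply, map_mul, ha m n h, hb m n h]
  one_mem' m n h := by simp only [Pi.one_apply, map_one]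
  add_mem' ha hb m n h := by simp only [Pi.add_apply, map_add, ha m n h, hb m n h]
  zero_mem' m n h := by simp only [Pi.zero_apply, map_zero]
  neg_mem' ha m n h := by simp only [Pi.neg_apply, map_neg, ha m n h]

/-- The pro-finite integers `Ẑ`, with the pro-finite topology. -/
abbrev ZHat : Type := zhatSubring

/-- The quandle structure `a ▷ b = 2a - b` on the pro-finite integers. -/
instance zhatQuandle : Quandle ZHat where
  act a b := 2 * a - b
  self_distrib := by intro a b c; ring
  invAct a b := 2 * a - b
  left_inv a b := by change 2 * a - (2 * a - b) = b; ring
  right_inv a b := by change 2 * a - (2 * a - b) = b; ring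
  fix := by intro a; ring

end ArtinSchreier

open ArtinSchreier

namespace ArtinSchreier

open Topology Filter

/-! ### Topology of the pro-finite integers -/

/-! Both sides are compared with $\widehat{\mathbb Z}$ under point reflections.

An involution of the pro-finite dihedral group becomes a reflection in every finite dihedral
quotient, and the angles of these reflections form a pro-finite integer; this gives
`FQ2hat.quandleHomeoZHat`. Freeness becomes a statement about $\widehat{\mathbb Z}$ and the points
0, 1. Two points of an involutory quandle generate a dihedral orbit indexed by $\mathbb Z$
(`exists_dihedral_orbit`). In a pro-finite quandle this orbit is periodic modulo each clopen set
(`periodic_mod_clopen`), so it extends continuously to $\widehat{\mathbb Z}$.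

For Laurent series, an involution of an algebraically closed field forces characteristic 0
(`charZero_of_involution`), so otherwise both quandles are empty. In characteristic 0 let $k$ be an
algebraic closure of $F$ embedded in that of $F(\!(t)\!)$. By Newton–Puiseux
(`IsSeriesValuation.eq_top_of_roots_mem`) an automorphism $\sigma$ is determined by its restriction
to $k$ and by the $c\in\widehat{\mathbb Z}$ with $\sigma\rho_n=\zeta_n^{c}\rho_n$, where the
$\rho_n$ are compatible roots of $t$. Every pair occurs (`IsSeriesValuation.exists_galois`).

The decisive fact is that involutions invert all roots of unity
(`map_mul_self_eq_one_of_involution`). Hence every lift of an involution of $k$ is again an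
involution, with arbitrary $c$, and conjugation acts on the cocycles by $2a-b$. Conversely, no
involution becomes trivial on $k$, because it moves $\sqrt{-1}$. The resulting continuous bijection
is a homeomorphism by compactness. -/

theorem zhat_ext {a b : ZHat} (h : ∀ n, a.1 n = b.1 n) : a = b := Subtype.ext (funext h)

@[simp]
theorem zhat_intCast_apply (z : ℤ) (n : ℕ+) : (z : ZHat).1 n = (z : ZMod n) := rfl

theorem zhat_act (a b : ZHat) : a ◃ b = 2 * a - b := rfl

theorem continuous_zhat_apply (n : ℕ+) : Continuous fun a : ZHat => a.1 n :=
  (continuous_apply n).comp continuous_subtype_val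

theorem isOpen_zhat_congruence (a : ZHat) (n : ℕ+) : IsOpen {b : ZHat | b.1 n = a.1 n} :=
  (isOpen_discrete {a.1 n}).preimage (continuous_zhat_apply n)

theorem exists_congruence_subset {a : ZHat} {U : Set ZHat} (hU : U ∈ 𝓝 a) :
    ∃ n : ℕ+, {b : ZHat | b.1 n = a.1 n} ⊆ U := by
  obtain ⟨V, hV, hVU⟩ := mem_nhds_subtype _ _ _ |>.mp hU
  rw [mem_nhds_iff] at hV
  obtain ⟨W, hWV, hWo, haW⟩ := hV
  obtain ⟨I, u, hu, hI⟩ := isOpen_pi_iff.mp hWo _ haW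
  -- A basic open set constrains finitely many coordinates; congruence modulo a common multiple of
  -- their indices fixes all of them.
  refine ⟨∏ i ∈ I, i, fun b hb => hVU (hWV (hI fun i hi => ?_))⟩
  have hd : (i : ℕ) ∣ ((∏ i ∈ I, i : ℕ+) : ℕ) := PNat.dvd_iff.mp (Finset.dvd_prod_of_mem _ hi)
  have : b.1 i = a.1 i := by
    rw [← b.2 i _ hd, ← a.2 i _ hd, show b.1 _ = a.1 _ from hb]
  change b.1 i ∈ u i
  rw [this]
  exact (hu i hi).2

theorem exists_int_congruent (a : ZHat) (n : ℕ+) : ∃ z : ℤ, (z : ZHat).1 n = a.1 n :=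
  ⟨(a.1 n).cast, ZMod.intCast_zmod_cast _⟩

theorem denseRange_intCast_zhat : DenseRange (Int.cast : ℤ → ZHat) := by
  intro a
  rw [mem_closure_iff_nhds]
  intro U hU
  obtain ⟨n, hn⟩ := exists_congruence_subset hU
  obtain ⟨z, hz⟩ := exists_int_congruent a n
  exact ⟨z, hn hz, z, rfl⟩

theorem isClosed_zhatSubring : IsClosed (zhatSubring : Set (∀ n : ℕ+, ZMod n)) := by
  have : (zhatSubring : Set (∀ n : ℕ+, ZMod n)) =
      ⋂ (m : ℕ+) (n : ℕ+) (h : (m : ℕ) ∣ n), {a | ZMod.castHom h (ZMod m) (a n) = a m} := by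
    ext a
    simp only [Set.mem_iInter]
    rfl
  rw [this]
  refine isClosed_iInter fun m => isClosed_iInter fun n => isClosed_iInter fun h => ?_
  exact isClosed_eq (continuous_of_discreteTopology.comp (continuous_apply n)) (continuous_apply m)

instance compactSpace_zhat : CompactSpace ZHat :=
  haveI (n : ℕ+) : CompactSpace (ZMod n) := Finite.compactSpace
  isCompact_iff_compactSpace.mp isClosed_zhatSubring.isCompact

theorem isProfiniteInvolutory_zhat : IsProfiniteInvolutory ZHat where
  involutory a b := by
    change 2 * a - (2 * a - b) = b
    ring
  continuous_act := by
    change Continuous fun p : ZHat × ZHat => 2 * p.1 - p.2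
    fun_prop
  compact := inferInstance
  hausdorff := inferInstance
  totallyDisconnected := inferInstance

/-- A map on the integers with values in a pro-finite space extends to the pro-finite integers if
it is periodic modulo every clopen set. -/
theorem exists_continuous_extension {R : Type v} [TopologicalSpace R] [CompactSpace R] [T2Space R]
    [TotallyDisconnectedSpace R] (f : ℤ → R)
    (hf : ∀ C : Set R, IsClopen C → ∃ n : ℕ+, ∀ c d : ℤ, (c : ZMod n) = d → (f c ∈ C ↔ f d ∈ C)) :
    ∃ g : ZHat → R, Continuous g ∧ ∀ z : ℤ, g z = f z := by
  let : TopologicalSpace ℤ := TopologicalSpace.induced (Int.cast : ℤ → ZHat) inferInstance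
  have di : IsDenseInducing (Int.cast : ℤ → ZHat) := ⟨⟨rfl⟩, denseRange_intCast_zhat⟩
  -- Periodicity means that a clopen set cannot separate integers close to `a`; hence a cluster
  -- point of `f` at `a` is a limit.
  have key (a : ZHat) (C : Set R) (hC : IsClopen C) :
      (∀ᶠ z in comap (Int.cast : ℤ → ZHat) (𝓝 a), f z ∈ C) ∨
      (∀ᶠ z in comap (Int.cast : ℤ → ZHat) (𝓝 a), f z ∉ C) := by
    obtain ⟨n, hn⟩ := hf C hC
    have hU : {b : ZHat | b.1 n = a.1 n} ∈ 𝓝 a := (isOpen_zhat_congruence a n).mem_nhds rfl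
    obtain ⟨w, hw⟩ := exists_int_congruent a n
    by_cases h : f w ∈ C
    · left
      filter_upwards [preimage_mem_comap hU] with z hz
      exact (hn z w (Eq.trans hz hw.symm)).mpr h
    · right
      filter_upwards [preimage_mem_comap hU] with z hz hzC
      exact h ((hn z w (Eq.trans hz hw.symm)).mp hzC)
  have lim (a : ZHat) : ∃ c, Tendsto f (comap (Int.cast : ℤ → ZHat) (𝓝 a)) (𝓝 c) := by
    have := di.comap_nhds_neBot a
    obtain ⟨c, hc⟩ := exists_clusterPt_of_compactSpace (map f (comap (Int.cast : ℤ → ZHat) (𝓝 a)))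
    refine ⟨c, fun U hU => ?_⟩
    obtain ⟨V, ⟨hcV, hV⟩, hVU⟩ := (nhds_basis_clopen c).mem_iff.mp hU
    rcases key a V hV with h | h
    · exact mem_of_superset h fun z hz => hVU hz
    · exfalso
      have := clusterPt_iff_frequently.mp hc V (hV.isOpen.mem_nhds hcV)
      exact this (eventually_map.mpr h)
  refine ⟨di.extend f, di.continuous_extend lim, fun z => ?_⟩
  refine di.extend_eq_of_tendsto fun U hU => ?_
  obtain ⟨V, ⟨hcV, hV⟩, hVU⟩ := (nhds_basis_clopen (f z)).mem_iff.mp hU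
  obtain ⟨n, hn⟩ := hf V hV
  have hN : {b : ZHat | b.1 n = (z : ZHat).1 n} ∈ 𝓝 (z : ZHat) :=
    (isOpen_zhat_congruence z n).mem_nhds rfl
  have hev : ∀ᶠ y in comap (Int.cast : ℤ → ZHat) (𝓝 z), f y ∈ U := by
    filter_upwards [preimage_mem_comap hN] with y hy
    exact hVU ((hn y z hy).mpr hcV)
  exact hev

/-! ### Dihedral orbits in involutory quandles -/

/-- Sets of integers that contain 0 and 1 and are closed under point reflections. -/
theorem int_mem_of_reflection_closed {S : Set ℤ} (h0 : 0 ∈ S) (h1 : 1 ∈ S)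
    (hS : ∀ a ∈ S, ∀ b ∈ S, 2 * a - b ∈ S) (z : ℤ) : z ∈ S := by
  have hup (n : ℕ) : (n : ℤ) ∈ S ∧ (n : ℤ) + 1 ∈ S := by
    induction n with
    | zero => simpa using ⟨h0, h1⟩
    | succ n ih =>
      refine ⟨by exact_mod_cast ih.2, ?_⟩
      have := hS _ ih.2 _ ih.1
      convert this using 1
      push_cast
      ring
  obtain ⟨n, rfl | rfl⟩ := z.eq_nat_or_neg
  · exact (hup n).1
  · simpa using hS 0 h0 n (hup n).1

section Orbit

variable {R : Type v} [Quandle R]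

/-- The symmetries in `x` and `y` are involutions, and their product `T` acts as translation by 2.
So even points are the `T`-orbit of `x` and odd points that of `y`. By self-distributivity the
symmetry in the `a`-th point is `T ^ a * L x`, where `L x` negates indices. -/
theorem exists_dihedral_orbit (hR : Rack.IsInvolutory R) (x y : R) :
    ∃ f : ℤ → R, f 0 = x ∧ f 1 = y ∧ ∀ a b, f (2 * a - b) = f a ◃ f b := by
  let L : R → Equiv.Perm R := Rack.act'
  have hL (p : R) : L p * L p = 1 := Equiv.ext fun q => hR p q
  have hLi (p : R) : (L p)⁻¹ = L p := inv_eq_of_mul_eq_one_left (hL p)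
  have hfix (p : R) : L p p = p := Quandle.fix
  have hconj (p q : R) : L (p ◃ q) = L p * L q * (L p)⁻¹ := Rack.ad_conj p q
  let T := L y * L x
  have hTinv : T⁻¹ = L x * L y := by rw [mul_inv_rev, hLi, hLi]
  have hxT (k : ℤ) : L x * T ^ k = T ^ (-k) * L x := by
    have h : L x * T * (L x)⁻¹ = T⁻¹ := by rw [hTinv, hLi, mul_assoc, mul_assoc, hL, mul_one]
    rw [zpow_neg, ← inv_zpow, ← h, conj_zpow, inv_mul_cancel_right]
  have hyx : L y = T * L x := by rw [mul_assoc, hL, mul_one]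
  have hTL (k : ℤ) (p : R) : L ((T ^ k) p) = T ^ k * L p * (T ^ k)⁻¹ := by
    have hT1 (p : R) : L (T p) = T * L p * T⁻¹ := by
      change L (y ◃ (x ◃ p)) = _
      rw [hconj, hconj, mul_inv_rev]
      simp only [mul_assoc, T]
    have hT2 (p : R) : L (T⁻¹ p) = T⁻¹ * L p * T := by
      have := hT1 (T⁻¹ p)
      rw [← Equiv.Perm.mul_apply, mul_inv_cancel, Equiv.Perm.one_apply] at this
      rw [this]
      group
    induction k with
    | zero => simp
    | succ k ih =>
      rw [add_comm, zpow_add, zpow_one, Equiv.Perm.mul_apply, hT1, ih]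
      group
    | pred k ih =>
      rw [sub_eq_add_neg, add_comm, zpow_add, zpow_neg_one, Equiv.Perm.mul_apply, hT2, ih]
      group
  let f : ℤ → R := fun n => (T ^ (n / 2)) (if n % 2 = 0 then x else y)
  have hfe (k : ℤ) : f (2 * k) = (T ^ k) x := by
    have h1 : 2 * k / 2 = k := by omega
    have h2 : 2 * k % 2 = 0 := by omega
    simp [f]
  have hfo (k : ℤ) : f (2 * k + 1) = (T ^ k) y := by
    have h1 : (2 * k + 1) / 2 = k := by omega
    have h2 : ¬ (2 * k + 1) % 2 = 0 := by omega
    simp only [f, h1, h2, if_false]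
  have hLf (a : ℤ) : L (f a) = T ^ a * L x := by
    obtain ⟨k, rfl | rfl⟩ := a.even_or_odd'
    · rw [hfe, hTL, mul_assoc, ← zpow_neg, hxT, ← mul_assoc, ← zpow_add]
      congr 2
      ring
    · rw [hfo, hTL, hyx, mul_assoc, mul_assoc, ← zpow_neg, hxT, ← mul_assoc, ← mul_assoc,
        ← zpow_add_one, ← zpow_add]
      congr 2
      ring
  have hxf (b : ℤ) : L x (f b) = f (-b) := by
    obtain ⟨k, rfl | rfl⟩ := b.even_or_odd'
    · rw [hfe, show -(2 * k) = 2 * -k by ring, hfe, ← Equiv.Perm.mul_apply, hxT,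
        Equiv.Perm.mul_apply, hfix]
    · rw [hfo, show -(2 * k + 1) = 2 * (-k - 1) + 1 by ring, hfo, ← Equiv.Perm.mul_apply, hxT,
        zpow_sub_one, hTinv, Equiv.Perm.mul_apply, Equiv.Perm.mul_apply, Equiv.Perm.mul_apply, hfix]
  have hTf (a b : ℤ) : (T ^ a) (f b) = f (2 * a + b) := by
    obtain ⟨k, rfl | rfl⟩ := b.even_or_odd'
    · rw [hfe, ← mul_add, hfe, zpow_add, Equiv.Perm.mul_apply]
    · rw [hfo, ← add_assoc, ← mul_add, hfo, zpow_add, Equiv.Perm.mul_apply]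
  refine ⟨f, by simpa using hfe 0, by simpa using hfo 0, fun a b => ?_⟩
  change _ = L (f a) (f b)
  rw [hLf, Equiv.Perm.mul_apply, hxf, hTf, ← sub_eq_add_neg]

/-- By compactness, finitely many classes of centres suffice to describe reflections as seen by `C`.
Two distinct integers `a`, `b` therefore have indistinguishable reflections, whose composite is the
translation by `2 * (b - a)`. -/
theorem periodic_mod_clopen [TopologicalSpace R] (hR : IsProfiniteInvolutory R) (f : ℤ → R)
    (hf : ∀ a b, f (2 * a - b) = f a ◃ f b) {C : Set R} (hC : IsClopen C) :
    ∃ n : ℕ+, ∀ c d : ℤ, (c : ZMod n) = d → (f c ∈ C ↔ f d ∈ C) := by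
  have := hR.compact
  let W : Set (R × R) := (fun p : R × R => p.1 ◃ p.2) ⁻¹' C
  have hW : IsClopen W := hC.preimage hR.continuous_act
  have hopen (p : R) : ∃ V : Set R, IsOpen V ∧ p ∈ V ∧ ∀ q ∈ V, ∀ r, q ◃ r ∈ C ↔ p ◃ r ∈ C := by
    have hp : IsClopen ((fun z : R × R => (p, z.2)) ⁻¹' W) :=
      hW.preimage (by fun_prop)
    -- `D` collects the pairs on which reflection in `p` and in the first entry are told apart by
    -- `C`. Projecting it along the compact factor gives a closed set that misses `p`.
    let D : Set (R × R) := (W ∩ ((fun z : R × R => (p, z.2)) ⁻¹' W)ᶜ) ∪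
      (Wᶜ ∩ ((fun z : R × R => (p, z.2)) ⁻¹' W))
    have hD : IsClosed D := ((hW.inter hp.compl).union (hW.compl.inter hp)).isClosed
    refine ⟨(Prod.fst '' D)ᶜ, (isClosedMap_fst_of_compactSpace _ hD).isOpen_compl, ?_, ?_⟩
    · rintro ⟨⟨p', r⟩, hr, rfl⟩
      rcases hr with ⟨h1, h2⟩ | ⟨h1, h2⟩
      · exact h2 h1
      · exact h1 h2
    · intro q hq r
      by_contra h
      refine hq ⟨(q, r), ?_, rfl⟩
      by_cases h1 : q ◃ r ∈ C
      · exact Or.inl ⟨h1, fun h2 => h ⟨fun _ => h2, fun _ => h1⟩⟩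
      · refine Or.inr ⟨h1, ?_⟩
        by_contra h2
        exact h ⟨fun h3 => absurd h3 h1, fun h3 => absurd h3 h2⟩
  choose V hVo hpV hV using hopen
  obtain ⟨t, ht⟩ := isCompact_univ.elim_finite_subcover V hVo
    fun p _ => Set.mem_iUnion.mpr ⟨p, hpV p⟩
  have hcov (a : ℤ) : ∃ p : t, f a ∈ V p := by
    obtain ⟨p, hp⟩ := Set.mem_iUnion.mp (ht (Set.mem_univ (f a)))
    obtain ⟨hpt, hp⟩ := Set.mem_iUnion.mp hp
    exact ⟨⟨p, hpt⟩, hp⟩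
  choose g hg using hcov
  obtain ⟨a, b, hab, hgab⟩ := Finite.exists_ne_map_eq_of_infinite g
  have hper (c : ℤ) : f (2 * a - c) ∈ C ↔ f (2 * b - c) ∈ C := by
    rw [hf, hf, hV _ _ (hg a), hV _ _ (hg b), hgab]
  have hper1 (c : ℤ) : f c ∈ C ↔ f (c + 2 * (b - a)) ∈ C := by
    have := hper (2 * a - c)
    convert this using 3
    · ring
    · ring
  have hper2 (k c : ℤ) : f c ∈ C ↔ f (c + 2 * (b - a) * k) ∈ C := by
    induction k with
    | zero => simp
    | succ k ih =>
      rw [ih, hper1]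
      ring_nf
    | pred k ih =>
      rw [ih, hper1 (c + 2 * (b - a) * (-k - 1))]
      ring_nf
  refine ⟨⟨(2 * (b - a)).natAbs, by omega⟩, fun c d hcd => ?_⟩
  rw [ZMod.intCast_eq_intCast_iff_dvd_sub] at hcd
  obtain ⟨k, hk⟩ := Int.natAbs_dvd.mp hcd
  rw [hper2 k c, ← hk]
  ring_nf

end Orbit

/-- Existence extends the dihedral orbit of `x` and `y`, compatibility passing from the dense
integers to the limit. Uniqueness holds because reflections generate all integers from 0 and 1. -/
theorem exists_dihedral_lift {R : Type v} [Quandle R] [TopologicalSpace R]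
    (hR : IsProfiniteInvolutory R) (x y : R) :
    ∃! g : ZHat →◃ R, Continuous g ∧ g 0 = x ∧ g 1 = y := by
  have := hR.compact
  have := hR.hausdorff
  have := hR.totallyDisconnected
  obtain ⟨f, hf0, hf1, hf⟩ := exists_dihedral_orbit hR.involutory x y
  obtain ⟨g, hg, hgf⟩ := exists_continuous_extension f fun C hC => periodic_mod_clopen hR f hf hC
  have hact (a b : ZHat) : g (a ◃ b) = g a ◃ g b := by
    refine denseRange_intCast_zhat.induction_on₂
      (p := fun a b => g (a ◃ b) = g a ◃ g b) ?_ (fun a b => ?_) a b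
    · exact isClosed_eq (hg.comp isProfiniteInvolutory_zhat.continuous_act)
        (hR.continuous_act.comp ((hg.comp continuous_fst).prodMk (hg.comp continuous_snd)))
    · rw [zhat_act, hgf, hgf, ← hf, ← hgf]
      push_cast
      rfl
  refine ⟨⟨g, fun {a b} => hact a b⟩, ⟨hg, ?_, ?_⟩, ?_⟩
  · exact (by simpa using hgf 0 : g 0 = f 0).trans hf0
  · exact (by simpa using hgf 1 : g 1 = f 1).trans hf1
  · rintro g' ⟨hg'c, hg'0, hg'1⟩
    have : (g' : ZHat → R) = g := by
      refine denseRange_intCast_zhat.equalizer hg'c hg (funext fun z => ?_)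
      refine int_mem_of_reflection_closed (S := {z : ℤ | g' z = g z}) ?_ ?_ ?_ z
      · simpa [hg'0, hf0] using (hgf 0).symm
      · simpa [hg'1, hf1] using (hgf 1).symm
      · intro a ha b hb
        have h : ((2 * a - b : ℤ) : ZHat) = (a : ZHat) ◃ (b : ZHat) := by
          rw [zhat_act]
          push_cast
          rfl
        change g' ((2 * a - b : ℤ) : ZHat) = g ((2 * a - b : ℤ) : ZHat)
        rw [h, hact, ShelfHom.map_act, show g' a = g a from ha, show g' b = g b from hb]
    exact DFunLike.coe_injective this

/-! ### Transport along isomorphisms of topological quandles -/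

theorem QuandleHomeo.isProfiniteInvolutory {A : Type u} {B : Type v} [Quandle A] [Quandle B]
    [TopologicalSpace A] [TopologicalSpace B] (e : QuandleHomeo A B)
    (hB : IsProfiniteInvolutory B) : IsProfiniteInvolutory A where
  involutory x y := by
    apply e.toHomeomorph.injective
    change e.toFun _ = e.toFun _
    rw [e.map_act', e.map_act', hB.involutory]
  continuous_act := by
    have h : Continuous fun p : A × A => e.toHomeomorph.symm (e.toFun p.1 ◃ e.toFun p.2) :=
      e.toHomeomorph.symm.continuous.comp (hB.continuous_act.comp
        ((e.toHomeomorph.continuous.comp continuous_fst).prodMk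
          (e.toHomeomorph.continuous.comp continuous_snd)))
    convert h using 2 with p
    rw [← e.map_act']
    exact (e.toHomeomorph.symm_apply_apply _).symm
  compact := haveI := hB.compact; e.toHomeomorph.symm.compactSpace
  hausdorff := haveI := hB.hausdorff; e.toHomeomorph.symm.t2Space
  totallyDisconnected :=
    have := hB.totallyDisconnected
    e.toHomeomorph.isEmbedding.isTotallyDisconnected_range.mp
      (isTotallyDisconnected_of_totallyDisconnectedSpace _)

def QuandleHomeo.symm {A : Type u} {B : Type v} [Quandle A] [Quandle B]
    [TopologicalSpace A] [TopologicalSpace B] (e : QuandleHomeo A B) : QuandleHomeo B A where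
  toHomeomorph := e.toHomeomorph.symm
  map_act' x y := by
    apply e.toHomeomorph.injective
    change e.toHomeomorph (e.toHomeomorph.symm _) =
      e.toFun (e.toHomeomorph.symm _ ◃ e.toHomeomorph.symm _)
    rw [e.map_act', e.toHomeomorph.apply_symm_apply]
    change _ = e.toHomeomorph (e.toHomeomorph.symm _) ◃ e.toHomeomorph (e.toHomeomorph.symm _)
    rw [e.toHomeomorph.apply_symm_apply, e.toHomeomorph.apply_symm_apply]

def QuandleHomeo.toShelfHom {A : Type u} {B : Type v} [Quandle A] [Quandle B]
    [TopologicalSpace A] [TopologicalSpace B] (e : QuandleHomeo A B) : A →◃ B :=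
  ⟨e.toFun, fun {x y} => e.map_act' x y⟩

/-- A quandle that corresponds to the pro-finite integers is free on the elements that correspond
to 0 and 1. -/
theorem isFree_of_quandleHomeo_zhat {Q : Type u} [Quandle Q] [TopologicalSpace Q]
    (e : QuandleHomeo Q ZHat) (ι : Fin 2 → Q) (h0 : e.toFun (ι 0) = 0) (h1 : e.toFun (ι 1) = 1) :
    IsFreeProfiniteInvolutory.{u, v, 0} ι where
  profinite := e.isProfiniteInvolutory isProfiniteInvolutory_zhat
  continuous_ι := continuous_of_discreteTopology
  existsUnique_lift R _ _ hR f _ := by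
    obtain ⟨g, ⟨hgc, hg0, hg1⟩, hg⟩ := exists_dihedral_lift hR (f 0) (f 1)
    have h0' : e.toHomeomorph.symm 0 = ι 0 := e.toHomeomorph.symm_apply_eq.mpr h0.symm
    have h1' : e.toHomeomorph.symm 1 = ι 1 := e.toHomeomorph.symm_apply_eq.mpr h1.symm
    refine ⟨g.comp e.toShelfHom, ⟨hgc.comp e.toHomeomorph.continuous, ?_⟩, ?_⟩
    · intro s
      fin_cases s
      · exact (congrArg g h0).trans hg0
      · exact (congrArg g h1).trans hg1
    · rintro k ⟨hkc, hk⟩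
      have := hg (k.comp e.symm.toShelfHom)
        ⟨hkc.comp e.toHomeomorph.symm.continuous, (congrArg k h0').trans (hk 0),
          (congrArg k h1').trans (hk 1)⟩
      refine DFunLike.coe_injective (funext fun q => ?_)
      rw [← this]
      exact congrArg k (e.toHomeomorph.symm_apply_apply q).symm

end ArtinSchreier

namespace ArtinSchreier

open Topology Filter

/-! ### The infinite dihedral group and its finite quotients -/

theorem F2.of_mul_self {S : Type u} (s : S) :
    (PresentedGroup.of s : F2 S) * PresentedGroup.of s = 1 := by
  have := PresentedGroup.one_of_mem (rels := Set.range fun s : S => FreeGroup.of s ^ 2)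
    (Set.mem_range_self s)
  rw [← pow_two]
  simpa using! this

theorem F2.of_inv {S : Type u} (s : S) :
    (PresentedGroup.of s : F2 S)⁻¹ = PresentedGroup.of s :=
  inv_eq_of_mul_eq_one_left (F2.of_mul_self s)

/-- The product of the two generators of the infinite dihedral group. -/
def F2.rot : F2 (Fin 2) := PresentedGroup.of 0 * PresentedGroup.of 1

theorem F2.rot_zpow_mul_of_zero (z : ℤ) :
    F2.rot ^ z * PresentedGroup.of 0 = PresentedGroup.of 0 * F2.rot ^ (-z) := by
  have h : PresentedGroup.of 0 * F2.rot * (PresentedGroup.of 0)⁻¹ = F2.rot⁻¹ := by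
    rw [F2.rot, mul_inv_rev, F2.of_inv, F2.of_inv, ← mul_assoc, F2.of_mul_self, one_mul]
  have h2 : F2.rot ^ (-z) = PresentedGroup.of 0 * F2.rot ^ z * (PresentedGroup.of 0)⁻¹ := by
    rw [← conj_zpow, h, inv_zpow, zpow_neg]
  rw [h2, F2.of_inv, ← mul_assoc, ← mul_assoc, F2.of_mul_self, one_mul]

theorem F2.normal_form (w : F2 (Fin 2)) :
    ∃ z : ℤ, w = F2.rot ^ z ∨ w = PresentedGroup.of 0 * F2.rot ^ z := by
  induction w using PresentedGroup.induction_on with | _ x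
  induction x using FreeGroup.induction_on with
  | C1 => exact ⟨0, Or.inl (by simp)⟩
  | of i =>
    fin_cases i
    · exact ⟨0, Or.inr (by rw [zpow_zero, mul_one]; rfl)⟩
    · refine ⟨1, Or.inr ?_⟩
      rw [zpow_one, F2.rot, ← mul_assoc, F2.of_mul_self, one_mul]
      rfl
  | inv_of i ih =>
    obtain ⟨z, h | h⟩ := ih
    · exact ⟨-z, Or.inl (by rw [map_inv, h, zpow_neg])⟩
    · refine ⟨z, Or.inr ?_⟩
      rw [map_inv, h, mul_inv_rev, F2.of_inv, ← zpow_neg, F2.rot_zpow_mul_of_zero, neg_neg]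
  | mul x y hx hy =>
    obtain ⟨a, ha | ha⟩ := hx <;> obtain ⟨b, hb | hb⟩ := hy
    · exact ⟨a + b, Or.inl (by rw [map_mul, ha, hb, zpow_add])⟩
    · refine ⟨-a + b, Or.inr ?_⟩
      rw [map_mul, ha, hb, ← mul_assoc, F2.rot_zpow_mul_of_zero, mul_assoc, ← zpow_add]
    · exact ⟨a + b, Or.inr (by rw [map_mul, ha, hb, mul_assoc, zpow_add])⟩
    · refine ⟨-a + b, Or.inl ?_⟩
      rw [map_mul, ha, hb, mul_assoc, ← mul_assoc (F2.rot ^ a), F2.rot_zpow_mul_of_zero, mul_assoc,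
        ← mul_assoc, F2.of_mul_self, one_mul, ← zpow_add]

/-- The homomorphism from the infinite dihedral group to a finite dihedral group that maps the
generators to neighbouring reflections. -/
def F2.toDihedral (n : ℕ+) : F2 (Fin 2) →* DihedralGroup n :=
  PresentedGroup.toGroup (f := ![DihedralGroup.sr 0, DihedralGroup.sr 1]) (by
    rintro _ ⟨s, rfl⟩
    rw [map_pow, FreeGroup.lift_apply_of, pow_two]
    fin_cases s <;> exact DihedralGroup.sr_mul_self _)

@[simp]
theorem F2.toDihedral_of_zero (n : ℕ+) :
    F2.toDihedral n (PresentedGroup.of 0) = DihedralGroup.sr 0 := PresentedGroup.toGroup.of _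

@[simp]
theorem F2.toDihedral_of_one (n : ℕ+) :
    F2.toDihedral n (PresentedGroup.of 1) = DihedralGroup.sr 1 := PresentedGroup.toGroup.of _

@[simp]
theorem F2.toDihedral_rot_zpow (n : ℕ+) (z : ℤ) :
    F2.toDihedral n (F2.rot ^ z) = DihedralGroup.r (z : ZMod n) := by
  rw [map_zpow, F2.rot, map_mul, F2.toDihedral_of_zero, F2.toDihedral_of_one,
    DihedralGroup.sr_mul_sr, sub_zero, DihedralGroup.r_one_zpow]

theorem F2.toDihedral_of_zero_mul_rot_zpow (n : ℕ+) (z : ℤ) :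
    F2.toDihedral n (PresentedGroup.of 0 * F2.rot ^ z) = DihedralGroup.sr (z : ZMod n) := by
  rw [map_mul, F2.toDihedral_rot_zpow, F2.toDihedral_of_zero, DihedralGroup.sr_mul_r, zero_add]

/-- Dihedral quotients are cofinal: for `n` the index of `N`, the kernel consists of powers of
`F2.rot ^ n`, which lies in `N`. -/
theorem F2.ker_toDihedral_le (N : FiniteIndexNormalSubgroup (F2 (Fin 2))) :
    ∃ n : ℕ+, (F2.toDihedral n).ker ≤ N.toSubgroup := by
  obtain ⟨n, hn⟩ : ∃ n : ℕ+, (n : ℕ) = N.toSubgroup.index :=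
    ⟨⟨_, Nat.pos_of_ne_zero Subgroup.FiniteIndex.index_ne_zero⟩, rfl⟩
  refine ⟨n, fun w hw => ?_⟩
  rw [MonoidHom.mem_ker] at hw
  obtain ⟨z, rfl | rfl⟩ := F2.normal_form w
  · rw [F2.toDihedral_rot_zpow, DihedralGroup.one_def, DihedralGroup.r.injEq,
      ZMod.intCast_zmod_eq_zero_iff_dvd] at hw
    obtain ⟨k, rfl⟩ := hw
    rw [zpow_mul]
    refine zpow_mem ?_ k
    rw [zpow_natCast, hn]
    exact Subgroup.pow_index_mem N.toSubgroup F2.rot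
  · rw [F2.toDihedral_of_zero_mul_rot_zpow, DihedralGroup.one_def] at hw
    exact absurd hw (by simp [-DihedralGroup.r_zero])

/-! ### The pro-finite dihedral group -/

/-- The kernel of the map to a finite dihedral group. -/
def F2.dihedralKer (n : ℕ+) : FiniteIndexNormalSubgroup (F2 (Fin 2)) :=
  haveI : NeZero (n : ℕ) := ⟨n.ne_zero⟩
  haveI : Finite (DihedralGroup n) := Finite.of_equiv _ DihedralGroup.equivSum.symm
  haveI : (F2.toDihedral n).ker.FiniteIndex := inferInstance
  { toSubgroup := (F2.toDihedral n).ker }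

/-- The projection from the pro-finite completion of a group to one of its finite quotients. -/
def F2hat.proj {S : Type u} (N : FiniteIndexNormalSubgroup (F2 S)) :
    F2hat S →* F2 S ⧸ N.toSubgroup where
  toFun x := x.1 N
  map_one' := rfl
  map_mul' _ _ := rfl

theorem F2hat.isLocallyConstant_proj {S : Type u} (N : FiniteIndexNormalSubgroup (F2 S)) :
    IsLocallyConstant (F2hat.proj N) := by
  rw [IsLocallyConstant.iff_isOpen_fiber]
  intro y
  let D := (ProfiniteGrp.ProfiniteCompletion.diagram (GrpCat.of (F2 S))).obj N
  have : DiscreteTopology D := ⟨rfl⟩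
  exact (isOpen_discrete ({y} : Set D)).preimage ((continuous_apply N).comp continuous_subtype_val)

theorem F2hat.ext_proj {S : Type u} {x y : F2hat S} (h : ∀ N, F2hat.proj N x = F2hat.proj N y) :
    x = y := Subtype.ext (funext h)

/-- The quotient by the intersection dominates both quotients, so a representative there serves for
both. -/
theorem F2hat.exists_proj_eq {S : Type u} (x : F2hat S) (M N : FiniteIndexNormalSubgroup (F2 S)) :
    ∃ w : F2 S, F2hat.proj M x = w ∧ F2hat.proj N x = w := by
  have : (M.toSubgroup ⊓ N.toSubgroup).FiniteIndex := inferInstance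
  let L : FiniteIndexNormalSubgroup (F2 S) := { toSubgroup := M.toSubgroup ⊓ N.toSubgroup }
  obtain ⟨w, hw⟩ := QuotientGroup.mk_surjective (F2hat.proj L x)
  have hLM : L ≤ M := fun _ h => h.1
  have hLN : L ≤ N := fun _ h => h.2
  have hM := x.2 (CategoryTheory.homOfLE hLM)
  have hN := x.2 (CategoryTheory.homOfLE hLN)
  exact ⟨w, hM.symm.trans (congrArg (QuotientGroup.map _ _ (MonoidHom.id _) hLM) hw.symm),
    hN.symm.trans (congrArg (QuotientGroup.map _ _ (MonoidHom.id _) hLN) hw.symm)⟩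

/-- The projection from the pro-finite dihedral group to a finite dihedral group. -/
noncomputable def F2hat.toDihedral (n : ℕ+) : F2hat (Fin 2) →* DihedralGroup n :=
  (QuotientGroup.kerLift (F2.toDihedral n)).comp (F2hat.proj (F2.dihedralKer n))

theorem F2hat.toDihedral_of (n : ℕ+) (s : Fin 2) :
    F2hat.toDihedral n (F2hat.of s) = F2.toDihedral n (PresentedGroup.of s) := rfl

theorem F2hat.toDihedral_eq {n : ℕ+} {x : F2hat (Fin 2)} {w : F2 (Fin 2)}
    (h : F2hat.proj (F2.dihedralKer n) x = w) : F2hat.toDihedral n x = F2.toDihedral n w :=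
  congrArg (QuotientGroup.kerLift (F2.toDihedral n)) h

theorem F2hat.exists_toDihedral_eq (x : F2hat (Fin 2)) (m n : ℕ+) :
    ∃ w : F2 (Fin 2), F2hat.toDihedral m x = F2.toDihedral m w ∧
      F2hat.toDihedral n x = F2.toDihedral n w := by
  obtain ⟨w, hm, hn⟩ := F2hat.exists_proj_eq x (F2.dihedralKer m) (F2.dihedralKer n)
  exact ⟨w, F2hat.toDihedral_eq hm, F2hat.toDihedral_eq hn⟩

theorem F2hat.isLocallyConstant_toDihedral (n : ℕ+) : IsLocallyConstant (F2hat.toDihedral n) :=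
  (F2hat.isLocallyConstant_proj (F2.dihedralKer n)).comp (QuotientGroup.kerLift (F2.toDihedral n))

theorem F2hat.eq_one_of_toDihedral {x : F2hat (Fin 2)} (h : ∀ n, F2hat.toDihedral n x = 1) :
    x = 1 := by
  refine F2hat.ext_proj fun N => ?_
  obtain ⟨n, hn⟩ := F2.ker_toDihedral_le N
  obtain ⟨w, hw, hw'⟩ := F2hat.exists_proj_eq x (F2.dihedralKer n) N
  rw [map_one, hw', QuotientGroup.eq_one_iff]
  apply hn
  rw [MonoidHom.mem_ker, ← F2hat.toDihedral_eq hw, h]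

theorem F2hat.eq_of_toDihedral {x y : F2hat (Fin 2)}
    (h : ∀ n, F2hat.toDihedral n x = F2hat.toDihedral n y) : x = y := by
  rw [← mul_inv_eq_one]
  exact F2hat.eq_one_of_toDihedral fun n => by rw [map_mul, map_inv, h, mul_inv_cancel]

theorem F2hat.exists_r_or_sr (x : F2hat (Fin 2)) (m n : ℕ+) : ∃ z : ℤ,
    (F2hat.toDihedral m x = DihedralGroup.r (z : ZMod m) ∧
      F2hat.toDihedral n x = DihedralGroup.r (z : ZMod n)) ∨
    (F2hat.toDihedral m x = DihedralGroup.sr (z : ZMod m) ∧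
      F2hat.toDihedral n x = DihedralGroup.sr (z : ZMod n)) := by
  obtain ⟨w, hm, hn⟩ := F2hat.exists_toDihedral_eq x m n
  obtain ⟨z, rfl | rfl⟩ := F2.normal_form w
  · exact ⟨z, Or.inl ⟨by simpa using hm, by simpa using hn⟩⟩
  · exact ⟨z, Or.inr ⟨by simpa only [F2.toDihedral_of_zero_mul_rot_zpow] using hm,
      by simpa only [F2.toDihedral_of_zero_mul_rot_zpow] using hn⟩⟩

/-- The pro-finite dihedral group has no involutions among its rotations. -/
theorem F2hat.exists_sr_of_involution {x : F2hat (Fin 2)} (hx : x ^ 2 = 1) (hx1 : x ≠ 1)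
    (n : ℕ+) : ∃ a, F2hat.toDihedral n x = DihedralGroup.sr a := by
  by_contra hr
  refine hx1 (F2hat.eq_one_of_toDihedral fun m => ?_)
  -- Being a rotation does not depend on the level. Level `2 * m` is used because a rotation of
  -- order dividing 2 there becomes trivial at level `m`.
  obtain ⟨z, ⟨h1, h2⟩ | ⟨-, h2⟩⟩ := F2hat.exists_r_or_sr x n (2 * m)
  · obtain ⟨y, ⟨h3, h4⟩ | ⟨-, h4⟩⟩ := F2hat.exists_r_or_sr x m (2 * m)
    · have h5 : (F2hat.toDihedral (2 * m) x) ^ 2 = 1 := by rw [← map_pow, hx, map_one]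
      rw [h4, DihedralGroup.r_pow, DihedralGroup.one_def, DihedralGroup.r.injEq] at h5
      have h6 : ((y * (2 : ℕ) : ℤ) : ZMod (2 * m : ℕ+)) = 0 := by
        rw [Int.cast_mul, Int.cast_natCast]
        exact h5
      rw [ZMod.intCast_zmod_eq_zero_iff_dvd] at h6
      push_cast at h6
      have h7 : (m : ℤ) ∣ y := by
        rw [mul_comm] at h6
        exact (mul_dvd_mul_iff_right (two_ne_zero)).mp h6
      rw [h3, DihedralGroup.one_def, (ZMod.intCast_zmod_eq_zero_iff_dvd _ _).mpr]
      exact_mod_cast h7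
    · rw [h2] at h4
      exact absurd h4 (by simp)
  · obtain ⟨y, ⟨-, h4⟩ | ⟨h3, -⟩⟩ := F2hat.exists_r_or_sr x n (2 * m)
    · rw [h2] at h4
      exact absurd h4 (by simp)
    · exact (hr ⟨_, h3⟩).elim

/-- The rotation angle of an involution in the pro-finite dihedral group. -/
noncomputable def FQ2hat.angle (x : FQ2hat (Fin 2)) (n : ℕ+) : ZMod n :=
  (F2hat.exists_sr_of_involution x.2.1 x.2.2 n).choose

theorem FQ2hat.toDihedral_eq_sr_angle (x : FQ2hat (Fin 2)) (n : ℕ+) :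
    F2hat.toDihedral n x.1 = DihedralGroup.sr (x.angle n) :=
  (F2hat.exists_sr_of_involution x.2.1 x.2.2 n).choose_spec

theorem FQ2hat.angle_eq {x : FQ2hat (Fin 2)} {n : ℕ+} {a : ZMod n}
    (h : F2hat.toDihedral n x.1 = DihedralGroup.sr a) : x.angle n = a := by
  rw [FQ2hat.toDihedral_eq_sr_angle] at h
  exact DihedralGroup.sr.inj h

/-- The pro-finite integer that corresponds to an involution in the pro-finite dihedral group. -/
noncomputable def FQ2hat.toZHat (x : FQ2hat (Fin 2)) : ZHat :=
  ⟨x.angle, fun m n h => by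
    obtain ⟨z, ⟨h1, -⟩ | ⟨h1, h2⟩⟩ := F2hat.exists_r_or_sr x.1 m n
    · rw [FQ2hat.toDihedral_eq_sr_angle] at h1
      exact absurd h1 (by simp)
    · rw [FQ2hat.angle_eq h1, FQ2hat.angle_eq h2]
      exact map_intCast _ z⟩

theorem FQ2hat.toZHat_of (s : Fin 2) : (FQ2hat.of s).toZHat = (![0, 1] : Fin 2 → ZHat) s := by
  refine zhat_ext fun n => FQ2hat.angle_eq ((F2hat.toDihedral_of n s).trans ?_)
  fin_cases s
  · exact F2.toDihedral_of_zero n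
  · exact F2.toDihedral_of_one n

theorem FQ2hat.toZHat_act (x y : FQ2hat (Fin 2)) : (x ◃ y).toZHat = x.toZHat ◃ y.toZHat := by
  refine zhat_ext fun n => FQ2hat.angle_eq ?_
  change F2hat.toDihedral n (x.1 * y.1 * x.1⁻¹) =
    DihedralGroup.sr ((2 * x.toZHat - y.toZHat).1 n)
  rw [map_mul, map_mul, map_inv, x.toDihedral_eq_sr_angle, y.toDihedral_eq_sr_angle,
    DihedralGroup.inv_sr, DihedralGroup.sr_mul_sr, DihedralGroup.r_mul_sr]
  congr 1
  change _ = 2 * x.angle n - y.angle n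
  ring

theorem FQ2hat.toZHat_injective : Function.Injective FQ2hat.toZHat := by
  intro x y h
  refine Subtype.ext (F2hat.eq_of_toDihedral fun n => ?_)
  rw [x.toDihedral_eq_sr_angle, y.toDihedral_eq_sr_angle]
  exact congrArg DihedralGroup.sr (congrFun (congrArg Subtype.val h) n)

theorem FQ2hat.continuous_toZHat : Continuous FQ2hat.toZHat := by
  refine Continuous.subtype_mk (continuous_pi fun n => ?_) _
  refine IsLocallyConstant.continuous ?_
  have h : IsLocallyConstant fun x : FQ2hat (Fin 2) => F2hat.toDihedral n x.1 :=
    (F2hat.isLocallyConstant_toDihedral n).comp_continuous continuous_subtype_val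
  rw [IsLocallyConstant.iff_eventually_eq] at h ⊢
  intro x
  filter_upwards [h x] with y hy
  rw [x.toDihedral_eq_sr_angle] at hy
  exact FQ2hat.angle_eq hy

/-- The condition `x ≠ 1` is not closed by itself, but involutions are exactly the elements that are
reflections at level 1, a clopen condition. -/
instance FQ2hat.compactSpace : CompactSpace (FQ2hat (Fin 2)) := by
  refine isCompact_iff_compactSpace.mp (IsClosed.isCompact ?_)
  have h : {x : F2hat (Fin 2) | x ^ 2 = 1 ∧ x ≠ 1} =
      F2hat.toDihedral 1 ⁻¹' Set.range DihedralGroup.sr := by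
    ext x
    constructor
    · rintro ⟨h1, h2⟩
      obtain ⟨a, ha⟩ := F2hat.exists_sr_of_involution h1 h2 1
      exact ⟨a, ha.symm⟩
    · rintro ⟨a, ha⟩
      refine ⟨F2hat.eq_one_of_toDihedral fun n => ?_, ?_⟩
      · obtain ⟨z, ⟨h1, -⟩ | ⟨-, h2⟩⟩ := F2hat.exists_r_or_sr x 1 n
        · rw [← ha] at h1
          exact absurd h1 (by simp)
        · rw [map_pow, h2, pow_two, DihedralGroup.sr_mul_self]
      · rintro rfl
        rw [map_one, DihedralGroup.one_def] at ha
        exact absurd ha (by simp)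
  change IsClosed {x : F2hat (Fin 2) | x ^ 2 = 1 ∧ x ≠ 1}
  rw [h]
  rw [← isOpen_compl_iff]
  exact F2hat.isLocallyConstant_toDihedral 1 (Set.range DihedralGroup.sr)ᶜ

/-- The image is compact and, being closed under reflections and containing 0 and 1, contains the
dense set of integers. -/
theorem FQ2hat.toZHat_surjective : Function.Surjective FQ2hat.toZHat := by
  have hcl : IsClosed (Set.range FQ2hat.toZHat) :=
    (isCompact_range FQ2hat.continuous_toZHat).isClosed
  have hint (z : ℤ) : (z : ZHat) ∈ Set.range FQ2hat.toZHat := by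
    refine int_mem_of_reflection_closed (S := {z : ℤ | (z : ZHat) ∈ Set.range FQ2hat.toZHat})
      ⟨FQ2hat.of 0, ?_⟩ ⟨FQ2hat.of 1, ?_⟩ ?_ z
    · simp [FQ2hat.toZHat_of]
    · simp [FQ2hat.toZHat_of]
    · rintro a ⟨x, hx⟩ b ⟨y, hy⟩
      refine ⟨x ◃ y, ?_⟩
      rw [FQ2hat.toZHat_act, hx, hy, zhat_act]
      push_cast
      rfl
  intro a
  have : Set.range FQ2hat.toZHat = Set.univ := by
    rw [← hcl.closure_eq]
    exact (denseRange_intCast_zhat.mono (by rintro _ ⟨z, rfl⟩; exact hint z)).closure_eq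
  exact Set.eq_univ_iff_forall.mp this a

/-- The involutions of the pro-finite dihedral group correspond to the pro-finite integers. -/
noncomputable def FQ2hat.quandleHomeoZHat : QuandleHomeo (FQ2hat (Fin 2)) ZHat where
  toHomeomorph := Continuous.homeoOfEquivCompactToT2
    (f := Equiv.ofBijective _ ⟨FQ2hat.toZHat_injective, FQ2hat.toZHat_surjective⟩)
    FQ2hat.continuous_toZHat
  map_act' := FQ2hat.toZHat_act

theorem FQ2hat.isFreeProfiniteInvolutory :
    IsFreeProfiniteInvolutory.{0, v, 0} (FQ2hat.of : Fin 2 → FQ2hat (Fin 2)) :=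
  isFree_of_quandleHomeo_zhat FQ2hat.quandleHomeoZHat FQ2hat.of
    (FQ2hat.toZHat_of 0) (FQ2hat.toZHat_of 1)

end ArtinSchreier

namespace ArtinSchreier

/-! ### Involutions of algebraically closed fields -/

section Involution

variable {Ω : Type u} [Field Ω] [IsAlgClosed Ω] {s : Ω →+* Ω}

/-- In characteristic 2 some `e` satisfies `s e = e + 1`. Taking traces of solutions of `w ^ 2 + w =
e * b` solves `c ^ 2 + c = b` in the fixed field. For `b = e * s e = e ^ 2 + e` this makes `e`
fixed. -/
theorem two_ne_zero_of_involution (hs : ∀ x, s (s x) = x) (hs1 : ∃ x, s x ≠ x) :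
    (2 : Ω) ≠ 0 := by
  intro h2
  have hadd (x : Ω) : x + x = 0 := by rw [← two_mul, h2, zero_mul]
  obtain ⟨x, hx⟩ := hs1
  have hb0 : x + s x ≠ 0 := fun h => hx (by linear_combination h - hadd x)
  have hb : s (x + s x) = x + s x := by rw [map_add, hs, add_comm]
  obtain ⟨e, he⟩ : ∃ e, e + s e = 1 := by
    refine ⟨x / (x + s x), ?_⟩
    rw [map_div₀, hb, ← add_div, div_self hb0]
  have hAS (b : Ω) (hb : s b = b) : ∃ c, s c = c ∧ c ^ 2 + c = b := by
    obtain ⟨w, hw⟩ := IsAlgClosed.exists_root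
      (Polynomial.X ^ 2 + Polynomial.X - Polynomial.C (e * b)) (by
        have : (Polynomial.X ^ 2 + Polynomial.X - Polynomial.C (e * b)).degree = 2 := by
          compute_degree!
        rw [this]
        decide)
    have hw' : w ^ 2 + w = e * b := by simpa [sub_eq_zero] using hw
    refine ⟨w + s w, by rw [map_add, hs, add_comm], ?_⟩
    have h3 : (s w) ^ 2 + s w = s e * b := by rw [← map_pow, ← map_add, hw', map_mul, hb]
    linear_combination hw' + h3 + b * he + w * s w * h2
  obtain ⟨c, hc, hce⟩ := hAS (e * s e) (by rw [map_mul, hs, mul_comm])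
  have hse : s e = e + 1 := by linear_combination he - hadd e
  have h : (e - c) * (e + c + 1) = 0 := by
    rw [hse] at hce
    linear_combination -hce
  have hfix : s e = e := by
    rcases mul_eq_zero.mp h with h | h
    · rw [sub_eq_zero.mp h, hc]
    · have : e = -c - 1 := by linear_combination h
      rw [this, map_sub, map_neg, hc, map_one]
  rw [hse] at hfix
  exact one_ne_zero (add_eq_left.mp hfix)

/-- If `i` were fixed, take `y` with square `d = x - s x`. The norm `y * s y` is fixed and its
square is `(i * d) ^ 2`, yet `s` negates `i * d`, so `d = 0`. -/
theorem map_sqrt_neg_one_of_involution (hs : ∀ x, s (s x) = x) (hs1 : ∃ x, s x ≠ x) {i : Ω}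
    (hi : i ^ 2 = -1) : s i = -i := by
  have h2 := two_ne_zero_of_involution hs hs1
  have hsi : (s i) ^ 2 = i ^ 2 := by rw [← map_pow, hi, map_neg, map_one]
  rcases sq_eq_sq_iff_eq_or_eq_neg.mp hsi with hsi | hsi
  · exfalso
    obtain ⟨x, hx⟩ := hs1
    obtain ⟨y, hy⟩ := IsAlgClosed.exists_pow_nat_eq (x - s x) (n := 2) (by norm_num)
    have hn : s (y * s y) = y * s y := by rw [map_mul, hs, mul_comm]
    have hsy : (s y) ^ 2 = -(x - s x) := by rw [← map_pow, hy, map_sub, hs, neg_sub]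
    have hn2 : (y * s y) ^ 2 = (i * (x - s x)) ^ 2 := by
      rw [mul_pow, hy, hsy, mul_pow, hi]
      ring
    have hsx : s (i * (x - s x)) = -(i * (x - s x)) := by
      rw [map_mul, hsi, map_sub, hs]
      ring
    have hz : i * (x - s x) = 0 := by
      have h3 : i * (x - s x) = -(i * (x - s x)) := by
        rcases sq_eq_sq_iff_eq_or_eq_neg.mp hn2 with h | h
        · rw [← hsx, ← h, hn]
        · rw [← hsx, ← neg_eq_iff_eq_neg.mpr h, map_neg, hn]
      have h4 : 2 * (i * (x - s x)) = 0 := by linear_combination h3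
      exact (mul_eq_zero.mp h4).resolve_left h2
    rcases mul_eq_zero.mp hz with h | h
    · rw [h] at hi
      exact one_ne_zero (neg_eq_zero.mp (hi.symm.trans (by ring)))
    · exact hx (sub_eq_zero.mp h).symm
  · exact hsi

theorem sq_ne_neg_one_of_fixed (hs : ∀ x, s (s x) = x) (hs1 : ∃ x, s x ≠ x) {c : Ω}
    (hc : s c = c) : c ^ 2 ≠ -1 := by
  intro h
  have h1 := map_sqrt_neg_one_of_involution hs hs1 h
  have h2 : 2 * c = 0 := by linear_combination h1 - hc
  have h3 := (mul_eq_zero.mp h2).resolve_left (two_ne_zero_of_involution hs hs1)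
  rw [h3] at h
  exact one_ne_zero (neg_eq_zero.mp (h.symm.trans (by ring)))

/-- Take the norm of a square root of `a + b * i`. -/
theorem exists_fixed_sq_eq_sq_add_sq (hs : ∀ x, s (s x) = x) (hs1 : ∃ x, s x ≠ x) {a b : Ω}
    (ha : s a = a) (hb : s b = b) : ∃ c, s c = c ∧ c ^ 2 = a ^ 2 + b ^ 2 := by
  obtain ⟨i, hi⟩ := IsAlgClosed.exists_pow_nat_eq (-1 : Ω) (n := 2) (by norm_num)
  obtain ⟨y, hy⟩ := IsAlgClosed.exists_pow_nat_eq (a + b * i) (n := 2) (by norm_num)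
  refine ⟨y * s y, by rw [map_mul, hs, mul_comm], ?_⟩
  rw [mul_pow, ← map_pow, hy, map_add, map_mul, ha, hb,
    map_sqrt_neg_one_of_involution hs hs1 hi]
  linear_combination -b ^ 2 * hi

/-- Modulo a prime, -1 is a sum of two squares, and the prime field is fixed; so -1 would be the
square of a fixed element. -/
theorem charZero_of_involution (hs : ∀ x, s (s x) = x) (hs1 : ∃ x, s x ≠ x) : CharZero Ω := by
  obtain ⟨p, hp⟩ := CharP.exists Ω
  rcases CharP.char_is_prime_or_zero Ω p with h | rfl
  · exfalso
    have : Fact p.Prime := ⟨h⟩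
    obtain ⟨a, b, hab⟩ := ZMod.sq_add_sq p (-1)
    have hfix (a : ZMod p) : s (ZMod.castHom dvd_rfl Ω a) = ZMod.castHom dvd_rfl Ω a :=
      congrArg (fun f : ZMod p →+* Ω => f a) (Subsingleton.elim (s.comp (ZMod.castHom dvd_rfl Ω))
        (ZMod.castHom dvd_rfl Ω))
    obtain ⟨c, hc, hcab⟩ := exists_fixed_sq_eq_sq_add_sq hs hs1 (hfix a) (hfix b)
    refine sq_ne_neg_one_of_fixed hs hs1 hc ?_
    rw [hcab, ← map_pow, ← map_pow, ← map_add, hab, map_neg, map_one]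
  · exact CharP.charP_to_charZero Ω

/-- The norm `w` of `ζ` is the square of a fixed element. If `w ≠ 1`, the geometric sum of its
powers vanishes, and moving the term 1 across writes -1 as `w` times a sum of fixed squares, hence
as a fixed square. -/
theorem map_mul_self_eq_one_of_involution (hs : ∀ x, s (s x) = x) (hs1 : ∃ x, s x ≠ x) {ζ : Ω}
    {n : ℕ} (hn : n ≠ 0) (hζ : ζ ^ n = 1) : s ζ * ζ = 1 := by
  obtain ⟨y, hy⟩ := IsAlgClosed.exists_pow_nat_eq ζ (n := 2) (by norm_num)
  have hr : s (y * s y) = y * s y := by rw [map_mul, hs, mul_comm]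
  have hw : s ζ * ζ = (y * s y) ^ 2 := by rw [mul_pow, ← map_pow, hy, mul_comm]
  have hsum (m : ℕ) : ∃ c, s c = c ∧ c ^ 2 = ∑ j ∈ Finset.range m, (s ζ * ζ) ^ j := by
    induction m with
    | zero => exact ⟨0, map_zero s, by simp⟩
    | succ m ih =>
      obtain ⟨c, hc, hcm⟩ := ih
      obtain ⟨d, hd, hdm⟩ := exists_fixed_sq_eq_sq_add_sq hs hs1 hc
        (show s ((y * s y) ^ m) = _ by rw [map_pow, hr])
      refine ⟨d, hd, ?_⟩
      rw [hdm, Finset.sum_range_succ, hcm, hw, ← pow_mul, ← pow_mul, mul_comm m]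
  obtain ⟨m, rfl⟩ := Nat.exists_eq_succ_of_ne_zero hn
  have h1 : (∑ j ∈ Finset.range (m + 1), (s ζ * ζ) ^ j) * (s ζ * ζ - 1) = 0 := by
    rw [geom_sum_mul, mul_pow, ← map_pow, hζ, map_one, one_mul, sub_self]
  rcases mul_eq_zero.mp h1 with h | h
  · exfalso
    obtain ⟨c, hc, hcm⟩ := hsum m
    have h2 : s (y * s y * c) = y * s y * c := by rw [map_mul, hr, hc]
    refine sq_ne_neg_one_of_fixed hs hs1 h2 ?_
    rw [mul_pow, hcm, ← hw, Finset.mul_sum]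
    rw [Finset.sum_range_succ'] at h
    simp only [pow_succ', pow_zero] at h
    linear_combination h
  · exact sub_eq_zero.mp h

end Involution

section Galois

variable {K : Type u} {Ω : Type v} [Field K] [Field Ω] [Algebra K Ω]

theorem Involutions.apply_apply (s : Involutions Gal(Ω/K)) (x : Ω) :
    s.1 (s.1 x) = x := by
  have := s.2.1
  rw [pow_two] at this
  exact AlgEquiv.congr_fun this x

theorem Involutions.exists_apply_ne (s : Involutions Gal(Ω/K)) : ∃ x, s.1 x ≠ x := by
  by_contra! h
  exact s.2.2 (AlgEquiv.ext h)

variable [IsAlgClosed Ω]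

theorem Involutions.charZero (s : Involutions Gal(Ω/K)) : CharZero Ω :=
  charZero_of_involution (s := (s.1 : Ω →+* Ω)) s.apply_apply s.exists_apply_ne

theorem Involutions.apply_root_of_unity (s : Involutions Gal(Ω/K)) {ζ : Ω} {n : ℕ} (hn : n ≠ 0)
    (hζ : ζ ^ n = 1) : s.1 ζ = ζ⁻¹ :=
  eq_inv_of_mul_eq_one_left
    (map_mul_self_eq_one_of_involution (s := (s.1 : Ω →+* Ω)) s.apply_apply s.exists_apply_ne hn hζ)

theorem Involutions.apply_sqrt_neg_one (s : Involutions Gal(Ω/K)) {i : Ω} (hi : i ^ 2 = -1) :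
    s.1 i = -i :=
  map_sqrt_neg_one_of_involution (s := (s.1 : Ω →+* Ω)) s.apply_apply s.exists_apply_ne hi

end Galois

end ArtinSchreier

namespace ArtinSchreier

open Polynomial
open scoped NNReal

/-! ### Valuations on algebraic extensions of fields of Laurent series -/

/-- A valuation on an algebraic extension `Ω` of `K` that is invariant under the Galois group, and
whose restriction to `K` is discrete with uniformizer `t` and coefficient field `F`. -/
structure IsSeriesValuation (F : Type*) {K Ω : Type*} [Field F] [Field K] [Field Ω] [Algebra F Ω]
    [Algebra K Ω] (t : K) (v : Valuation Ω ℝ≥0) : Prop where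
  map_galois : ∀ (σ : Gal(Ω/K)) (x : Ω), v (σ x) = v x
  map_coeff : ∀ a : F, a ≠ 0 → v (algebraMap F Ω a) = 1
  uniformizer_ne_zero : t ≠ 0
  uniformizer_lt_one : v (algebraMap K Ω t) < 1
  exists_zpow : ∀ y : K, y ≠ 0 → ∃ z : ℤ, v (algebraMap K Ω y) = v (algebraMap K Ω t) ^ z
  exists_coeff : ∀ y : K, v (algebraMap K Ω y) ≤ 1 →
    ∃ a : F, v (algebraMap K Ω y - algebraMap F Ω a) < 1
  map_minpoly_coeff_le_one : ∀ x : Ω, v x ≤ 1 →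
    ∀ i, v (algebraMap K Ω ((minpoly K x).coeff i)) ≤ 1

section Invariant

variable {E Ω : Type*} [Field E] [Field Ω] [Algebra E Ω] [IsAlgClosed Ω] [IsGalois E Ω]

omit [IsAlgClosed Ω] in
theorem exists_galois_of_mem_aroots {x r : Ω} (hr : r ∈ (minpoly E x).aroots Ω) :
    ∃ σ : Gal(Ω/E), σ x = r :=
  minpoly.exists_algEquiv_of_root' (Algebra.IsAlgebraic.isAlgebraic x) (mem_aroots'.mp hr).2

/-- The constant coefficient is, up to sign, the product of the conjugates, which all have the same
value. -/
theorem map_minpoly_coeff_zero {v : Valuation Ω ℝ≥0} (hv : ∀ (σ : Gal(Ω/E)) (x : Ω), v (σ x) = v x)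
    (x : Ω) :
    v (algebraMap E Ω ((minpoly E x).coeff 0)) = v x ^ (minpoly E x).natDegree := by
  have hm : (minpoly E x).Monic := minpoly.monic (Algebra.IsIntegral.isIntegral x)
  rw [← coeff_map, (IsAlgClosed.splits _).coeff_zero_eq_prod_roots_of_monic (hm.map _), map_mul,
    map_pow, Valuation.map_neg, map_one, one_pow, one_mul, map_multiset_prod,
    Multiset.eq_replicate_of_mem (a := v x) (s := Multiset.map _ _), Multiset.prod_replicate,
    Multiset.card_map]
  · congr 1
    exact IsAlgClosed.card_aroots_eq_natDegree
  · intro b hb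
    obtain ⟨r, hr, rfl⟩ := Multiset.mem_map.mp hb
    obtain ⟨σ, rfl⟩ := exists_galois_of_mem_aroots hr
    exact hv σ x

end Invariant

theorem valuation_multiset_sum_lt_one {ι Ω : Type*} [Field Ω] (v : Valuation Ω ℝ≥0)
    (S : Multiset ι) (f : ι → Ω) (hf : ∀ r ∈ S, v (f r) < 1) : v (S.map f).sum < 1 := by
  induction S using Multiset.induction with
  | empty => simp
  | cons a S ih =>
    rw [Multiset.map_cons, Multiset.sum_cons]
    exact v.map_add_lt (hf a (Multiset.mem_cons_self a S))
      (ih fun r hr => hf r (Multiset.mem_cons_of_mem hr))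

/-! ### Newton–Puiseux and Kummer theory from the valuation -/

namespace IsSeriesValuation

variable {F K k Ω : Type*} [Field F] [Field K] [Field k] [Field Ω] [Algebra F k]
  [Algebra F Ω] [Algebra K Ω] [Algebra k Ω] [IsScalarTower F k Ω]
  {t : K} {v : Valuation Ω ℝ≥0}

theorem map_coeff_le_one (h : IsSeriesValuation F t v) (a : F) : v (algebraMap F Ω a) ≤ 1 := by
  by_cases ha : a = 0
  · rw [ha, map_zero, map_zero]
    exact zero_le_one
  · exact (h.map_coeff a ha).le

theorem map_uniformizer_ne_zero (h : IsSeriesValuation F t v) : v (algebraMap K Ω t) ≠ 0 := by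
  rw [Valuation.ne_zero_iff]
  simpa using h.uniformizer_ne_zero

theorem map_natCast [CharZero F] (h : IsSeriesValuation F t v) {n : ℕ} (hn : n ≠ 0) :
    v (n : Ω) = 1 := by
  rw [← _root_.map_natCast (algebraMap F Ω)]
  exact h.map_coeff _ (Nat.cast_ne_zero.mpr hn)

/-- Both `a` and its inverse are integral over `F`, hence lie in the valuation ring. -/
theorem map_algebraic [Algebra.IsAlgebraic F k] (h : IsSeriesValuation F t v) {a : k} (ha : a ≠ 0) :
    v (algebraMap k Ω a) = 1 := by
  have hle (a : k) : v (algebraMap k Ω a) ≤ 1 := by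
    let f : F →+* v.integer := (algebraMap F Ω).codRestrict v.integer h.map_coeff_le_one
    refine (Valuation.integer.integers v).mem_of_integral
      ⟨(minpoly F a).map f, (minpoly.monic (Algebra.IsIntegral.isIntegral a)).map f, ?_⟩
    rw [eval₂_map]
    have : (algebraMap v.integer Ω).comp f = algebraMap F Ω := rfl
    rw [this, ← aeval_def, aeval_algebraMap_apply, minpoly.aeval, map_zero]
  refine le_antisymm (hle a) ?_
  have h1 := hle a⁻¹
  rw [map_inv₀, map_inv₀] at h1
  exact (inv_le_one₀ (zero_lt_iff.mpr (by simpa using ha))).mp h1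

/-- Replacing the coefficients of the minimal polynomial by their residues in `F` gives a monic `q`
with `v (q x) < 1`. It splits over `k`, so one of its linear factors has value less than 1 at `x`.
-/
theorem exists_residue [Algebra.IsAlgebraic F k] [IsAlgClosed k] [Algebra.IsAlgebraic K Ω]
    (h : IsSeriesValuation F t v) {x : Ω} (hx : v x ≤ 1) :
    ∃ a : k, v (x - algebraMap k Ω a) < 1 := by
  have hm : (minpoly K x).Monic := minpoly.monic (Algebra.IsIntegral.isIntegral x)
  choose a ha using fun i => h.exists_coeff _ (h.map_minpoly_coeff_le_one x hx i)
  set d := (minpoly K x).natDegree with hd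
  let q : F[X] := X ^ d + ∑ i ∈ Finset.range d, C (a i) * X ^ i
  have hq : q.Monic := monic_X_pow_add (by
    simp_rw [← Fin.sum_univ_eq_sum_range (fun i => C (a i) * X ^ i), degree_sum_fin_lt])
  have hqx : v (aeval x q) < 1 := by
    have h0 : aeval x (minpoly K x) = 0 := minpoly.aeval K x
    have h1 : aeval x q = -∑ i ∈ Finset.range d,
        (algebraMap K Ω ((minpoly K x).coeff i) - algebraMap F Ω (a i)) * x ^ i := by
      rw [← sub_zero (aeval x q), ← h0]
      conv_lhs => rw [hm.as_sum]
      simp only [q, map_add, map_pow, map_sum, map_mul, aeval_X, aeval_C, sub_mul,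
        Finset.sum_sub_distrib, ← hd]
      ring
    rw [h1, Valuation.map_neg]
    refine v.map_sum_lt one_ne_zero fun i _ => ?_
    rw [map_mul, map_pow]
    exact mul_lt_one_of_lt_of_le (ha i) (pow_le_one₀ zero_le hx)
  have hq2 : aeval x q = ((q.map (algebraMap F k)).roots.map
      fun α => x - algebraMap k Ω α).prod := by
    rw [← aeval_map_algebraMap k,
      (IsAlgClosed.splits _).eq_prod_roots_of_monic (hq.map (algebraMap F k)),
      map_multiset_prod, Multiset.map_map, ← (IsAlgClosed.splits _).eq_prod_roots_of_monic
        (hq.map (algebraMap F k))]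
    simp
  by_contra! hge
  rw [hq2, map_multiset_prod, Multiset.map_map] at hqx
  refine absurd hqx (not_lt.mpr (Multiset.one_le_prod_of_one_le fun y hy => ?_))
  obtain ⟨α, -, rfl⟩ := Multiset.mem_map.mp hy
  exact hge α

variable [IsAlgClosed Ω] [IsGalois K Ω]

theorem exists_pow_eq_zpow (h : IsSeriesValuation F t v) {x : Ω} (hx : x ≠ 0) :
    ∃ n : ℕ, n ≠ 0 ∧ ∃ z : ℤ, v x ^ n = v (algebraMap K Ω t) ^ z := by
  have hi : IsIntegral K x := Algebra.IsIntegral.isIntegral x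
  obtain ⟨z, hz⟩ := h.exists_zpow _ (minpoly.coeff_zero_ne_zero hi hx)
  exact ⟨_, (minpoly.natDegree_pos hi).ne', z, by rw [← map_minpoly_coeff_zero h.map_galois, hz]⟩

/-- The theorem of Newton and Puiseux: adjoining all constants and all roots of the uniformizer
gives an algebraically closed field. -/
theorem eq_top_of_roots_mem [CharZero F] [Algebra.IsAlgebraic F k] [IsAlgClosed k]
    (h : IsSeriesValuation F t v)
    (M : IntermediateField K Ω) (hk : ∀ a : k, algebraMap k Ω a ∈ M)
    (ht : ∀ n : ℕ, n ≠ 0 → ∃ ρ ∈ M, ρ ^ n = algebraMap K Ω t) : M = ⊤ := by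
  refine eq_top_iff.mpr fun x _ => ?_
  have hi : IsIntegral M x := Algebra.IsIntegral.isIntegral x
  have hmon : (minpoly M x).Monic := minpoly.monic hi
  set S := (minpoly M x).aroots Ω with hS
  set d := (minpoly M x).natDegree with hd
  have hcard : S.card = d := IsAlgClosed.card_aroots_eq_natDegree
  have hd0 : (d : Ω) ≠ 0 := by
    intro h0
    have := h.map_natCast (minpoly.natDegree_pos hi).ne'
    rw [← hd, h0, map_zero] at this
    exact zero_ne_one this
  have hsum : S.sum ∈ M := by
    have h1 := (IsAlgClosed.splits
      ((minpoly M x).map (algebraMap M Ω))).nextCoeff_eq_neg_sum_roots_of_monic (hmon.map _)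
    rw [nextCoeff_map (algebraMap M Ω).injective] at h1
    rw [show S.sum = -algebraMap M Ω (minpoly M x).nextCoeff by rw [h1, neg_neg]]
    exact M.neg_mem (SetLike.coe_mem _)
  -- Subtracting the mean of the conjugates makes the trace zero; this is where characteristic 0
  -- enters.
  have hm : S.sum / d ∈ M := M.div_mem hsum (natCast_mem M d)
  by_contra hx
  have hy : x - S.sum / d ≠ 0 := fun h0 => hx (by rwa [sub_eq_zero.mp h0])
  obtain ⟨e, he, z, hz⟩ := h.exists_pow_eq_zpow hy
  obtain ⟨ρ, hρM, hρ⟩ := ht e he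
  have hq : v (ρ ^ z) = v (x - S.sum / d) := by
    refine (pow_left_inj₀ zero_le zero_le he).mp ?_
    rw [hz, ← map_pow, ← zpow_natCast, ← zpow_mul, mul_comm, zpow_mul, zpow_natCast, hρ, map_zpow₀]
  have hqM : ρ ^ z ∈ M := zpow_mem hρM z
  have hq0 : ρ ^ z ≠ 0 := by
    rw [← v.ne_zero_iff, hq, v.ne_zero_iff]
    exact hy
  have hu : v ((x - S.sum / d) / ρ ^ z) = 1 := by
    rw [map_div₀, hq, div_self (v.ne_zero_iff.mpr hy)]
  obtain ⟨a, ha⟩ := h.exists_residue (k := k) hu.le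
  have ha0 : a ≠ 0 := by
    rintro rfl
    rw [map_zero, sub_zero, hu] at ha
    exact lt_irrefl _ ha
  -- After scaling to a unit by an element of `M`, all conjugates share the nonzero residue `a`, as
  -- `a` is fixed. Their sum then has residue `d * a ≠ 0`, although the trace is zero.
  have hconj : ∀ r ∈ S, v ((r - S.sum / d) / ρ ^ z - algebraMap k Ω a) < 1 := by
    intro r hr
    obtain ⟨σ, rfl⟩ := exists_galois_of_mem_aroots hr
    have hσ (y : Ω) (hy : y ∈ M) : σ y = y := σ.commutes ⟨y, hy⟩
    have : (σ x - S.sum / d) / ρ ^ z - algebraMap k Ω a =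
        (σ.restrictScalars K) ((x - S.sum / d) / ρ ^ z - algebraMap k Ω a) := by
      rw [AlgEquiv.restrictScalars_apply, map_sub, map_div₀, map_sub, hσ _ hm, hσ _ hqM,
        hσ _ (hk a)]
    rw [this, h.map_galois]
    exact ha
  have hlt := valuation_multiset_sum_lt_one v S _ hconj
  have hval : (S.map fun r => (r - S.sum / d) / ρ ^ z - algebraMap k Ω a).sum =
      -(d * algebraMap k Ω a) := by
    rw [Multiset.sum_map_sub, Multiset.sum_map_div, Multiset.sum_map_sub, Multiset.map_id',
      Multiset.map_const', Multiset.map_const', Multiset.sum_replicate, Multiset.sum_replicate,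
      hcard, nsmul_eq_mul, nsmul_eq_mul, mul_div_cancel₀ _ hd0, sub_self, zero_div, zero_sub]
  rw [hval, Valuation.map_neg, map_mul, h.map_natCast (minpoly.natDegree_pos hi).ne',
    h.map_algebraic ha0, one_mul] at hlt
  exact lt_irrefl _ hlt

omit [IsAlgClosed Ω] in
-- Constants do not enlarge the value group: divide a combination of an `F`-basis of `k` by its
-- coefficient of largest value. The residue is nonzero by linear independence, so the value is that
-- of this coefficient.
theorem exists_zpow_of_mem_adjoin [Algebra F K] [IsScalarTower F K Ω] [Algebra.IsAlgebraic F k]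
    (h : IsSeriesValuation F t v) {e : Ω}
    (he : e ∈ IntermediateField.adjoin K (Set.range (algebraMap k Ω))) (he0 : e ≠ 0) :
    ∃ z : ℤ, v e = v (algebraMap K Ω t) ^ z := by
  let b := Module.Basis.ofVectorSpace F k
  have hspan : e ∈ Submodule.span K (Set.range fun i => algebraMap k Ω (b i)) := by
    have h1 : e ∈ Algebra.adjoin K (Set.range (algebraMap k Ω)) := by
      rw [← IntermediateField.adjoin_toSubalgebra_of_isAlgebraic
        fun x _ => Algebra.IsAlgebraic.isAlgebraic x]
      exact he
    have h2 : e ∈ Submodule.span K (Set.range (algebraMap k Ω)) := by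
      have h3 := Algebra.adjoin_eq_span K (Set.range (algebraMap k Ω))
      rw [show Set.range (algebraMap k Ω) = MonoidHom.mrange (algebraMap k Ω).toMonoidHom from rfl,
        Submonoid.closure_eq] at h3
      exact h3.le h1
    refine Submodule.span_le.mpr ?_ h2
    rintro _ ⟨a, rfl⟩
    rw [SetLike.mem_coe, ← b.linearCombination_repr a, Finsupp.linearCombination_apply,
      Finsupp.sum, map_sum]
    refine Submodule.sum_mem _ fun i _ => ?_
    rw [Algebra.smul_def, map_mul, ← IsScalarTower.algebraMap_apply F k Ω,
      IsScalarTower.algebraMap_apply F K Ω, ← Algebra.smul_def]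
    exact Submodule.smul_mem _ _ (Submodule.subset_span ⟨i, rfl⟩)
  obtain ⟨c, rfl⟩ := Finsupp.mem_span_range_iff_exists_finsupp.mp hspan
  have hc : c.support.Nonempty := by
    rw [Finsupp.support_nonempty_iff]
    rintro rfl
    exact he0 Finsupp.sum_zero_index
  obtain ⟨j, hj, hmax⟩ := c.support.exists_max_image (fun i => v (algebraMap K Ω (c i))) hc
  have hcj : c j ≠ 0 := Finsupp.mem_support_iff.mp hj
  have hvj : v (algebraMap K Ω (c j)) ≠ 0 := by
    rw [Valuation.ne_zero_iff]
    simpa using hcj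
  have hle (i) (hi : i ∈ c.support) : v (algebraMap K Ω (c i / c j)) ≤ 1 := by
    rw [map_div₀, map_div₀]
    exact div_le_one_of_le₀ (hmax i hi) zero_le
  have hres (i) : ∃ a : F, i ∈ c.support →
      v (algebraMap K Ω (c i / c j) - algebraMap F Ω a) < 1 := by
    by_cases hi : i ∈ c.support
    · obtain ⟨a, ha⟩ := h.exists_coeff _ (hle i hi)
      exact ⟨a, fun _ => ha⟩
    · exact ⟨0, fun h => absurd h hi⟩
  choose a ha using hres
  have haj : a j ≠ 0 := by
    intro h0
    have := ha j hj
    rw [h0, div_self hcj, map_one, map_zero, sub_zero, map_one] at this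
    exact lt_irrefl _ this
  have hα : ∑ i ∈ c.support, a i • b i ≠ 0 := fun h0 =>
    haj (linearIndependent_iff'.mp b.linearIndependent _ _ h0 j hj)
  have hb (i) : v (algebraMap k Ω (b i)) = 1 := h.map_algebraic (b.ne_zero i)
  have hdiff : v ((c.sum fun i y => y • algebraMap k Ω (b i)) / algebraMap K Ω (c j) -
      algebraMap k Ω (∑ i ∈ c.support, a i • b i)) < 1 := by
    have : (c.sum fun i y => y • algebraMap k Ω (b i)) / algebraMap K Ω (c j) -
        algebraMap k Ω (∑ i ∈ c.support, a i • b i) =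
        ∑ i ∈ c.support, (algebraMap K Ω (c i / c j) - algebraMap F Ω (a i)) *
          algebraMap k Ω (b i) := by
      rw [Finsupp.sum, Finset.sum_div, map_sum, ← Finset.sum_sub_distrib]
      refine Finset.sum_congr rfl fun i _ => ?_
      rw [Algebra.smul_def, Algebra.smul_def, map_mul, ← IsScalarTower.algebraMap_apply F k Ω,
        map_div₀]
      ring
    rw [this]
    refine v.map_sum_lt one_ne_zero fun i hi => ?_
    rw [map_mul, hb, mul_one]
    exact ha i hi
  have hα1 := h.map_algebraic hα
  have h1 : v ((c.sum fun i y => y • algebraMap k Ω (b i)) / algebraMap K Ω (c j)) = 1 := by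
    rw [← hα1] at hdiff ⊢
    exact v.map_eq_of_sub_lt hdiff
  obtain ⟨z, hz⟩ := h.exists_zpow _ hcj
  refine ⟨z, ?_⟩
  rw [map_div₀, div_eq_one_iff_eq hvj] at h1
  rw [h1, hz]

/-- Over `K` with all constants adjoined, the value of the norm of `ρ` is an integral power of that
of `t`, so `n` divides the degree of `ρ`. Hence `X ^ n - t` is its minimal polynomial, and `ξ * ρ`
is a conjugate. -/
theorem exists_galois_of_root_of_unity [Algebra F K] [IsScalarTower F K Ω]
    [Algebra.IsAlgebraic F k] (h : IsSeriesValuation F t v) {n : ℕ} (hn : n ≠ 0) {ρ ξ : Ω}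
    (hρ : ρ ^ n = algebraMap K Ω t) (hξ : ξ ^ n = 1) :
    ∃ σ : Gal(Ω/K), (∀ a : k, σ (algebraMap k Ω a) = algebraMap k Ω a) ∧ σ ρ = ξ * ρ := by
  let E := IntermediateField.adjoin K (Set.range (algebraMap k Ω))
  have hi : IsIntegral E ρ := Algebra.IsIntegral.isIntegral ρ
  have hρ0 : ρ ≠ 0 := by
    rintro rfl
    rw [zero_pow hn, eq_comm, map_eq_zero] at hρ
    exact h.uniformizer_ne_zero hρ
  have hP0 := minpoly.coeff_zero_ne_zero hi hρ0
  obtain ⟨z, hz⟩ := h.exists_zpow_of_mem_adjoin (k := k) ((minpoly E ρ).coeff 0).2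
    (by simpa using hP0)
  have hinv (σ : Gal(Ω/E)) (x : Ω) : v (σ x) = v x := h.map_galois (σ.restrictScalars K) x
  have h1 : v ρ ^ (minpoly E ρ).natDegree = v (algebraMap K Ω t) ^ z := by
    rw [← hz]
    exact (map_minpoly_coeff_zero hinv ρ).symm
  have h2 : v ρ ^ n = v (algebraMap K Ω t) := by rw [← map_pow, hρ]
  have h3 : ((minpoly E ρ).natDegree : ℤ) = z * n := by
    apply zpow_right_injective₀ (zero_lt_iff.mpr h.map_uniformizer_ne_zero)
      h.uniformizer_lt_one.ne
    simp only
    rw [zpow_mul, ← h1, zpow_natCast, zpow_natCast, ← pow_mul, mul_comm, pow_mul, h2]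
  have h4 : n ≤ (minpoly E ρ).natDegree :=
    Nat.le_of_dvd (minpoly.natDegree_pos hi) (by
      rw [← Int.natCast_dvd_natCast, h3]
      exact dvd_mul_left _ _)
  have hdvd : minpoly E ρ ∣ X ^ n - C (algebraMap K E t) := minpoly.dvd _ _ (by
    rw [map_sub, map_pow, aeval_X, aeval_C, hρ, ← IsScalarTower.algebraMap_apply, sub_self])
  have heq : X ^ n - C (algebraMap K E t) = minpoly E ρ :=
    eq_of_monic_of_dvd_of_natDegree_le (minpoly.monic hi) (monic_X_pow_sub_C _ hn) hdvd (by
      rwa [natDegree_X_pow_sub_C])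
  obtain ⟨σ, hσ⟩ := minpoly.exists_algEquiv_of_root' (K := E) (x := ξ * ρ) hi.isAlgebraic (by
    rw [← heq, map_sub, map_pow, aeval_X, aeval_C, mul_pow, hρ, hξ, one_mul,
      ← IsScalarTower.algebraMap_apply, sub_self])
  exact ⟨σ.restrictScalars K,
    fun a => σ.commutes ⟨_, IntermediateField.subset_adjoin K _ ⟨a, rfl⟩⟩, hσ⟩

omit [IsAlgClosed Ω] [IsGalois K Ω] in
-- The element is congruent to some constant of `F`, and distinct constants are never congruent.
theorem mem_range_of_mem_constants [Algebra F K] [IsScalarTower F K Ω] [Algebra.IsAlgebraic F k]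
    (h : IsSeriesValuation F t v) {a : k} {y : K} (hay : algebraMap k Ω a = algebraMap K Ω y) :
    a ∈ Set.range (algebraMap F k) := by
  have hy : v (algebraMap K Ω y) ≤ 1 := by
    rw [← hay]
    by_cases ha : a = 0
    · rw [ha, map_zero, map_zero]
      exact zero_le_one
    · exact (h.map_algebraic ha).le
  obtain ⟨b, hb⟩ := h.exists_coeff y hy
  refine ⟨b, ?_⟩
  by_contra hab
  rw [← hay, IsScalarTower.algebraMap_apply F k Ω, ← map_sub,
    h.map_algebraic (sub_ne_zero.mpr (Ne.symm hab))] at hb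
  exact lt_irrefl _ hb

end IsSeriesValuation

end ArtinSchreier

namespace ArtinSchreier

open Polynomial Topology
open scoped NNReal

/-! ### Continuity for Krull topologies -/

section Krull

variable {K Ω : Type*} [Field K] [Field Ω] [Algebra K Ω]

theorem isLocallyConstant_galois_apply [Algebra.IsIntegral K Ω] (x : Ω) :
    IsLocallyConstant fun σ : Gal(Ω/K) => σ x := by
  rw [IsLocallyConstant.iff_eventually_eq]
  intro σ
  have h : (MulAction.stabilizer Gal(Ω/K) x : Set Gal(Ω/K)) ∈ 𝓝 (1 : Gal(Ω/K)) :=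
    (stabilizer_isOpen_of_isIntegral x).mem_nhds (one_mem _)
  have hc : Filter.Tendsto (fun τ => σ⁻¹ * τ) (𝓝 σ) (𝓝 1) := by
    have : Continuous fun τ : Gal(Ω/K) => σ⁻¹ * τ := by fun_prop
    simpa using this.tendsto σ
  filter_upwards [hc h] with τ hτ
  have : σ⁻¹ (τ x) = x := hτ
  exact (AlgEquiv.symm_apply_eq σ).mp this

theorem continuous_galois_of_isLocallyConstant {X : Type*} [TopologicalSpace X]
    {f : X → Gal(Ω/K)} (hf : ∀ a, IsLocallyConstant fun x => f x a) : Continuous f := by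
  rw [continuous_iff_continuousAt]
  intro x U hU
  have hc : Filter.Tendsto (fun τ => f x * τ) (𝓝 1) (𝓝 (f x)) := by
    have : Continuous fun τ : Gal(Ω/K) => f x * τ := by fun_prop
    simpa using this.tendsto 1
  obtain ⟨E, hE, hEU⟩ := (krullTopology_mem_nhds_one_iff K Ω _).mp (hc hU)
  -- A Krull neighbourhood only tests a finite extension, hence a finite basis.
  have hev : ∀ᶠ y in 𝓝 x, ∀ i, f y (Module.finBasis K E i) = f x (Module.finBasis K E i) :=
    Filter.eventually_all.mpr fun i => (hf _).eventually_eq x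
  change ∀ᶠ y in 𝓝 x, f y ∈ U
  filter_upwards [hev] with y hy
  have hmem : (f x)⁻¹ * f y ∈ E.fixingSubgroup := by
    rw [IntermediateField.mem_fixingSubgroup_iff]
    intro e he
    have := LinearMap.congr_fun ((Module.finBasis K E).ext
      (f₁ := (f y).toLinearMap ∘ₗ E.val.toLinearMap) (f₂ := (f x).toLinearMap ∘ₗ E.val.toLinearMap)
      hy) ⟨e, he⟩
    exact (AlgEquiv.symm_apply_eq (f x)).mpr this
  have := hEU hmem
  rwa [Set.mem_preimage, mul_inv_cancel_left] at this

end Krull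

/-! ### Restriction to the field of constants -/

section Restriction

variable {F K k Ω : Type*} [Field F] [Field K] [Field k] [Field Ω] [Algebra F K] [Algebra F k]
  [Algebra F Ω] [Algebra K Ω] [Algebra k Ω] [IsScalarTower F k Ω] [IsScalarTower F K Ω]

variable (F K k Ω) in
/-- The restriction of automorphisms to the field of constants. -/
noncomputable def restrictConstants [Normal F k] : Gal(Ω/K) →* Gal(k/F) :=
  (AlgEquiv.restrictNormalHom k).comp (AlgEquiv.restrictScalarsHom F)

theorem algebraMap_restrictConstants [Normal F k] (σ : Gal(Ω/K)) (a : k) :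
    algebraMap k Ω (restrictConstants F K k Ω σ a) = σ (algebraMap k Ω a) :=
  AlgEquiv.restrictNormal_commutes (σ.restrictScalars F) k a

theorem continuous_restrictConstants [Normal F k] [Algebra.IsIntegral K Ω] :
    Continuous (restrictConstants F K k Ω) := by
  refine continuous_galois_of_isLocallyConstant fun a => ?_
  refine IsLocallyConstant.desc (fun σ => restrictConstants F K k Ω σ a) (algebraMap k Ω) ?_
    (algebraMap k Ω).injective
  have : (algebraMap k Ω ∘ fun σ => restrictConstants F K k Ω σ a) =
      fun σ : Gal(Ω/K) => σ (algebraMap k Ω a) := funext fun σ => algebraMap_restrictConstants σ a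
  rw [this]
  exact isLocallyConstant_galois_apply _

/-- The image is compact, hence closed, and its fixed field is `F`, because constants lying in `K`
lie in `F`. -/
theorem IsSeriesValuation.restrictConstants_surjective [IsGalois F k] [IsGalois K Ω]
    {t : K} {v : Valuation Ω ℝ≥0} (h : IsSeriesValuation F t v) :
    Function.Surjective (restrictConstants F K k Ω) := by
  let H : ClosedSubgroup Gal(k/F) :=
    { toSubgroup := (restrictConstants F K k Ω).range
      isClosed' := (isCompact_range continuous_restrictConstants).isClosed }
  have hfix : IntermediateField.fixedField H.toSubgroup = ⊥ := by
    refine eq_bot_iff.mpr fun a ha => ?_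
    rw [IntermediateField.mem_fixedField_iff] at ha
    obtain ⟨y, hy⟩ := (InfiniteGalois.mem_range_algebraMap_iff_fixed (k := K)
      (algebraMap k Ω a)).mpr fun σ => by
        rw [← algebraMap_restrictConstants (F := F), ha _ ⟨σ, rfl⟩]
    exact h.mem_range_of_mem_constants hy.symm
  have := InfiniteGalois.fixingSubgroup_fixedField H
  rw [hfix, IntermediateField.fixingSubgroup_bot] at this
  exact MonoidHom.range_eq_top.mp this.symm

end Restriction

/-! ### Kummer cocycles -/

/-- Compatible systems of primitive roots of unity and of roots of an element `t`. -/
structure KummerSystem {K : Type*} (k Ω : Type*) [Field K] [Field k] [Field Ω] [Algebra K Ω]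
    (t : K) where
  /-- a primitive root of unity of each order -/
  ζ : ℕ+ → k
  /-- a root of `t` of each order -/
  ρ : ℕ+ → Ω
  isPrimitiveRoot (n : ℕ+) : IsPrimitiveRoot (ζ n) n
  ζ_pow (m d : ℕ+) : ζ (m * d) ^ (d : ℕ) = ζ m
  pow_eq (n : ℕ+) : ρ n ^ (n : ℕ) = algebraMap K Ω t
  ρ_pow (m d : ℕ+) : ρ (m * d) ^ (d : ℕ) = ρ m

/-- The numbers $e^{2\pi i/n}$ are compatible and algebraic, so they can be transported from `ℂ` to
`k`. -/
theorem exists_compatible_roots_of_unity_of_algebra (Q k : Type*) [Field Q] [Algebra Q ℂ] [Field k]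
    [Algebra Q k] [IsAlgClosed k] :
    ∃ ζ : ℕ+ → k, (∀ n : ℕ+, IsPrimitiveRoot (ζ n) n) ∧
      ∀ m d : ℕ+, ζ (m * d) ^ (d : ℕ) = ζ m := by
  let e (n : ℕ+) : ℂ := Complex.exp (2 * Real.pi * Complex.I / (n : ℕ))
  have he (n : ℕ+) : IsPrimitiveRoot (e n) n := Complex.isPrimitiveRoot_exp n n.ne_zero
  have hcompat (m d : ℕ+) : e (m * d) ^ (d : ℕ) = e m := by
    have h1 : ((m : ℕ) : ℂ) ≠ 0 := by simp
    have h2 : ((d : ℕ) : ℂ) ≠ 0 := by simp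
    simp only [e]
    rw [← Complex.exp_nat_mul]
    congr 1
    push_cast
    field_simp
  have halg (n : ℕ+) : e n ∈ algebraicClosure Q ℂ :=
    mem_algebraicClosure_iff.mpr ((he n).isIntegral n.pos).tower_top.isAlgebraic
  have := algebraicClosure.isAlgebraic ℚ ℂ
  let φ : algebraicClosure Q ℂ →ₐ[Q] k := IsAlgClosed.lift
  refine ⟨fun n => φ ⟨e n, halg n⟩, fun n => ?_, fun m d => ?_⟩
  · refine IsPrimitiveRoot.map_of_injective (f := φ) ?_ φ.injective
    exact IsPrimitiveRoot.of_map_of_injective (f := (algebraicClosure Q ℂ).val) (he n)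
      Subtype.val_injective
  · rw [← map_pow]
    exact congrArg φ (Subtype.ext (hcompat m d))

theorem exists_compatible_roots_of_unity (k : Type*) [Field k] [CharZero k] [IsAlgClosed k] :
    ∃ ζ : ℕ+ → k, (∀ n : ℕ+, IsPrimitiveRoot (ζ n) n) ∧
      ∀ m d : ℕ+, ζ (m * d) ^ (d : ℕ) = ζ m :=
  exists_compatible_roots_of_unity_of_algebra ℚ k

theorem exists_compatible_roots {Ω : Type*} [Field Ω] [IsAlgClosed Ω] (t : Ω) :
    ∃ ρ : ℕ+ → Ω, (∀ n : ℕ+, ρ n ^ (n : ℕ) = t) ∧ ∀ m d : ℕ+, ρ (m * d) ^ (d : ℕ) = ρ m := by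
  choose root hroot using fun (x : Ω) (n : ℕ) =>
    IsAlgClosed.exists_pow_nat_eq x (n := n + 1) n.succ_pos
  let r : ℕ → Ω := fun n => Nat.rec t (fun n x => root x n) n
  have hr (n : ℕ) : r (n + 1) ^ (n + 1) = r n := hroot _ _
  have hasc (a c : ℕ) : r (a + c) ^ (a + 1).ascFactorial c = r a := by
    induction c with
    | zero => simp
    | succ c ih =>
      rw [Nat.ascFactorial_succ, pow_mul, ← add_assoc, show a + 1 + c = a + c + 1 by ring, hr, ih]
  have hfac (n : ℕ) : r n ^ n.factorial = t := by
    have := hasc 0 n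
    rwa [zero_add, zero_add, Nat.one_ascFactorial] at this
  -- The chain `r` consists of compatible roots of order `n!`; raising to the power `(n - 1)!`
  -- leaves an `n`-th root.
  refine ⟨fun n => r n ^ ((n : ℕ) - 1).factorial, fun n => ?_, fun m d => ?_⟩
  · rw [← pow_mul, mul_comm, Nat.mul_factorial_pred n.ne_zero, hfac]
  · obtain ⟨c, hc⟩ := Nat.exists_eq_add_of_le
      (show (m : ℕ) ≤ ((m * d : ℕ+) : ℕ) from Nat.le_mul_of_pos_right _ d.pos)
    have h1 := Nat.mul_factorial_pred (m * d).ne_zero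
    have h2 := Nat.mul_factorial_pred m.ne_zero
    have h3 := Nat.factorial_mul_ascFactorial m c
    simp only
    rw [← hasc m c, ← hc, ← pow_mul, ← pow_mul]
    congr 1
    apply Nat.eq_of_mul_eq_mul_left m.pos
    calc (m : ℕ) * ((((m * d : ℕ+) : ℕ) - 1).factorial * d)
        = ((m * d : ℕ+) : ℕ) * (((m * d : ℕ+) : ℕ) - 1).factorial := by
          rw [PNat.mul_coe]
          ring
      _ = (m : ℕ).factorial * ((m : ℕ) + 1).ascFactorial c := by rw [h1, h3, ← hc]
      _ = (m : ℕ) * (((m : ℕ) + 1).ascFactorial c * ((m : ℕ) - 1).factorial) := by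
          rw [← h2]
          ring

section Cocycle

variable {F K k Ω : Type*} [Field F] [Field K] [Field k] [Field Ω] [Algebra K Ω] [Algebra k Ω]
  {t : K} (κ : KummerSystem k Ω t)

namespace KummerSystem

theorem map_isPrimitiveRoot (n : ℕ+) : IsPrimitiveRoot (algebraMap k Ω (κ.ζ n)) n :=
  (κ.isPrimitiveRoot n).map_of_injective (algebraMap k Ω).injective

omit [Algebra k Ω] in
theorem ρ_ne_zero (ht : t ≠ 0) (n : ℕ+) : κ.ρ n ≠ 0 := by
  intro h
  have := κ.pow_eq n
  rw [h, zero_pow n.ne_zero, eq_comm, map_eq_zero] at this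
  exact ht this

theorem exists_cocycle (ht : t ≠ 0) (σ : Gal(Ω/K)) (n : ℕ+) :
    ∃ z : ℤ, σ (κ.ρ n) = algebraMap k Ω (κ.ζ n) ^ z * κ.ρ n := by
  have h : (σ (κ.ρ n) / κ.ρ n) ^ (n : ℕ) = 1 := by
    rw [div_pow, ← map_pow, κ.pow_eq, AlgEquiv.commutes, div_self]
    simpa using ht
  have : NeZero (n : ℕ) := ⟨n.ne_zero⟩
  obtain ⟨i, -, hi⟩ := (κ.map_isPrimitiveRoot n).eq_pow_of_pow_eq_one h
  refine ⟨i, ?_⟩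
  rw [zpow_natCast, hi, div_mul_cancel₀ _ (κ.ρ_ne_zero ht n)]

theorem zpow_ζ_eq_iff {n : ℕ+} {z w : ℤ} :
    algebraMap k Ω (κ.ζ n) ^ z = algebraMap k Ω (κ.ζ n) ^ w ↔ (z : ZMod n) = w := by
  have h0 := (κ.map_isPrimitiveRoot n).ne_zero n.ne_zero
  rw [ZMod.intCast_eq_intCast_iff_dvd_sub, ← (κ.map_isPrimitiveRoot n).zpow_eq_one_iff_dvd,
    zpow_sub₀ h0, div_eq_one_iff_eq (zpow_ne_zero _ h0), eq_comm]

theorem map_ρ_of_dvd {σ : Gal(Ω/K)} {m n : ℕ+} (h : m ∣ n) {z : ℤ}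
    (hz : σ (κ.ρ n) = algebraMap k Ω (κ.ζ n) ^ z * κ.ρ n) :
    σ (κ.ρ m) = algebraMap k Ω (κ.ζ m) ^ z * κ.ρ m := by
  obtain ⟨d, rfl⟩ := h
  rw [← κ.ρ_pow m d, ← κ.ζ_pow m d, map_pow, map_pow, hz, mul_pow, ← zpow_natCast, ← zpow_natCast,
    ← zpow_natCast, ← zpow_mul, ← zpow_mul, mul_comm z]

/-- The Kummer cocycle of an automorphism: its action on the roots of `t`. -/
noncomputable def cocycle (ht : t ≠ 0) (σ : Gal(Ω/K)) : ZHat :=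
  ⟨fun n => ((κ.exists_cocycle ht σ n).choose : ZMod n), fun m n h => by
    rw [ZMod.castHom_apply, ZMod.cast_intCast h, ← κ.zpow_ζ_eq_iff]
    apply mul_right_cancel₀ (κ.ρ_ne_zero ht m)
    rw [← (κ.exists_cocycle ht σ m).choose_spec]
    exact (κ.map_ρ_of_dvd (PNat.dvd_iff.mpr h) (κ.exists_cocycle ht σ n).choose_spec).symm⟩

theorem cocycle_apply_eq_iff (ht : t ≠ 0) {σ : Gal(Ω/K)} {n : ℕ+} {z : ℤ} :
    (κ.cocycle ht σ).1 n = z ↔ σ (κ.ρ n) = algebraMap k Ω (κ.ζ n) ^ z * κ.ρ n := by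
  change (((κ.exists_cocycle ht σ n).choose : ℤ) : ZMod n) = z ↔ _
  rw [← κ.zpow_ζ_eq_iff, ← mul_left_inj' (κ.ρ_ne_zero ht n),
    ← (κ.exists_cocycle ht σ n).choose_spec]

theorem continuous_cocycle [Algebra.IsIntegral K Ω] (ht : t ≠ 0) :
    Continuous (κ.cocycle ht : Gal(Ω/K) → ZHat) := by
  refine Continuous.subtype_mk (continuous_pi fun n => IsLocallyConstant.continuous ?_) _
  rw [IsLocallyConstant.iff_eventually_eq]
  intro σ
  filter_upwards [(isLocallyConstant_galois_apply (κ.ρ n)).eventually_eq σ] with τ hτ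
  obtain ⟨z, hz⟩ := κ.exists_cocycle ht σ n
  exact ((κ.cocycle_apply_eq_iff ht).mpr (Eq.trans hτ hz)).trans
    ((κ.cocycle_apply_eq_iff ht).mpr hz).symm

end KummerSystem

end Cocycle

/-! ### Involutions of the absolute Galois group of a field of Laurent series -/

section Main

variable {F K k Ω : Type*} [Field F] [Field K] [Field k] [Field Ω] [Algebra F K] [Algebra F k]
  [Algebra F Ω] [Algebra K Ω] [Algebra k Ω] [IsScalarTower F k Ω] [IsScalarTower F K Ω]
  [CharZero F] [IsGalois F k] [IsGalois K Ω] [IsAlgClosed k] [IsAlgClosed Ω]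
  {t : K} {v : Valuation Ω ℝ≥0}

omit [Algebra F K] [IsScalarTower F K Ω] in
theorem IsSeriesValuation.galois_eq_one (h : IsSeriesValuation F t v) (κ : KummerSystem k Ω t)
    {σ : Gal(Ω/K)} (hk : ∀ a : k, σ (algebraMap k Ω a) = algebraMap k Ω a)
    (hρ : ∀ n, σ (κ.ρ n) = κ.ρ n) : σ = 1 := by
  have := h.eq_top_of_roots_mem (k := k) (IntermediateField.fixedField (Subgroup.zpowers σ))
    (fun a => (IntermediateField.mem_fixedField_iff _ _).mpr ?_)
    fun n hn => ⟨κ.ρ ⟨n, Nat.pos_of_ne_zero hn⟩, (IntermediateField.mem_fixedField_iff _ _).mpr ?_,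
      κ.pow_eq _⟩
  · ext x
    have hx : x ∈ IntermediateField.fixedField (Subgroup.zpowers σ) := this ▸ trivial
    exact (IntermediateField.mem_fixedField_iff _ _).mp hx σ (Subgroup.mem_zpowers σ)
  · intro τ hτ
    exact (Subgroup.zpowers_le.mpr (show σ ∈ MulAction.stabilizer Gal(Ω/K) (algebraMap k Ω a)
      from hk a)) hτ
  · intro τ hτ
    exact (Subgroup.zpowers_le.mpr (show σ ∈ MulAction.stabilizer Gal(Ω/K) (κ.ρ _)
      from hρ _)) hτ

theorem IsSeriesValuation.galois_ext (h : IsSeriesValuation F t v) (κ : KummerSystem k Ω t)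
    {σ τ : Gal(Ω/K)} (hk : restrictConstants F K k Ω σ = restrictConstants F K k Ω τ)
    (hρ : ∀ n, σ (κ.ρ n) = τ (κ.ρ n)) : σ = τ := by
  rw [← inv_mul_eq_one, ← inv_inj, mul_inv_rev, inv_inv, inv_one]
  refine h.galois_eq_one κ (fun a => ?_) fun n => ?_
  · have h1 : σ (algebraMap k Ω a) = τ (algebraMap k Ω a) := by
      rw [← algebraMap_restrictConstants (F := F), hk, algebraMap_restrictConstants]
    exact (AlgEquiv.symm_apply_eq τ).mpr h1
  · exact (AlgEquiv.symm_apply_eq τ).mpr (hρ n)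

omit [CharZero F] [IsAlgClosed k] in
/-- Automorphisms of the constants and of the group of roots of the uniformizer lift. -/
theorem IsSeriesValuation.exists_galois (h : IsSeriesValuation F t v) (κ : KummerSystem k Ω t)
    (τ : Gal(k/F)) (c : ZHat) : ∃ σ : Gal(Ω/K), restrictConstants F K k Ω σ = τ ∧
      κ.cocycle h.uniformizer_ne_zero σ = c := by
  -- The conditions at the single levels cut out nonempty closed sets, directed by divisibility, in
  -- a compact group.
  let A (n : ℕ+) : Set Gal(Ω/K) := restrictConstants F K k Ω ⁻¹' {τ} ∩
    κ.cocycle h.uniformizer_ne_zero ⁻¹' {b | b.1 n = c.1 n}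
  have hcl (n : ℕ+) : IsClosed (A n) :=
    (isClosed_singleton.preimage continuous_restrictConstants).inter
      ((isClosed_discrete {c.1 n}).preimage
        ((continuous_zhat_apply n).comp (κ.continuous_cocycle h.uniformizer_ne_zero)))
  have hmono (m n : ℕ+) (hmn : m ∣ n) : A n ⊆ A m := by
    rintro σ ⟨h1, h2⟩
    refine ⟨h1, ?_⟩
    have hd := PNat.dvd_iff.mp hmn
    change (κ.cocycle h.uniformizer_ne_zero σ).1 m = c.1 m
    rw [← c.2 m n hd, ← (κ.cocycle h.uniformizer_ne_zero σ).2 m n hd]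
    exact congrArg _ h2
  have hne (n : ℕ+) : (A n).Nonempty := by
    obtain ⟨σ, hσ⟩ := h.restrictConstants_surjective τ
    obtain ⟨z, hz⟩ := exists_int_congruent c n
    obtain ⟨w, hw⟩ := κ.exists_cocycle h.uniformizer_ne_zero σ n
    -- A lift of `τ` with exponent `w` is corrected by an automorphism that is trivial on constants
    -- and contributes `z - w`.
    obtain ⟨g, hg, hgρ⟩ := h.exists_galois_of_root_of_unity (k := k)
      (ξ := algebraMap k Ω (κ.ζ n) ^ (z - w)) n.ne_zero (κ.pow_eq n) (by
        rw [← zpow_natCast, ← zpow_mul, mul_comm, zpow_mul, zpow_natCast,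
          (κ.map_isPrimitiveRoot n).pow_eq_one, one_zpow])
    refine ⟨g * σ, ?_, ?_⟩
    · change restrictConstants F K k Ω (g * σ) = τ
      rw [map_mul, hσ]
      have : restrictConstants F K k Ω g = 1 := by
        ext a
        apply (algebraMap k Ω).injective
        rw [algebraMap_restrictConstants, hg]
        rfl
      rw [this, one_mul]
    · change (κ.cocycle h.uniformizer_ne_zero (g * σ)).1 n = c.1 n
      rw [← hz, zhat_intCast_apply, κ.cocycle_apply_eq_iff, AlgEquiv.mul_apply, hw, map_mul,
        map_zpow₀, hg, hgρ, ← mul_assoc, ← zpow_add₀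
          ((κ.map_isPrimitiveRoot n).ne_zero n.ne_zero), add_sub_cancel]
  obtain ⟨σ, hσ⟩ := IsCompact.nonempty_iInter_of_directed_nonempty_isCompact_isClosed A
    (fun m n => ⟨m * n, hmono _ _ (dvd_mul_right m n), hmono _ _ (dvd_mul_left n m)⟩) hne
    (fun n => (hcl n).isCompact) hcl
  rw [Set.mem_iInter] at hσ
  exact ⟨σ, (hσ 1).1, zhat_ext fun n => (hσ n).2⟩

/-- An involution negates `i`, so `s ≠ 1` can be replaced by the closed condition `s i = -i`. -/
theorem compactSpace_involutions [CharZero K] : CompactSpace (Involutions Gal(Ω/K)) := by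
  refine isCompact_iff_compactSpace.mp (IsClosed.isCompact ?_)
  obtain ⟨i, hi⟩ := IsAlgClosed.exists_pow_nat_eq (-1 : Ω) (n := 2) (by norm_num)
  have h : {s : Gal(Ω/K) | s ^ 2 = 1 ∧ s ≠ 1} = {s | s ^ 2 = 1} ∩ {s | s i = -i} := by
    ext s
    constructor
    · intro hs
      exact ⟨hs.1, Involutions.apply_sqrt_neg_one ⟨s, hs⟩ hi⟩
    · rintro ⟨h1, h2⟩
      refine ⟨h1, ?_⟩
      rintro rfl
      have : CharZero Ω := charZero_of_injective_algebraMap (algebraMap K Ω).injective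
      have h3 : i = 0 := self_eq_neg.mp h2
      rw [h3] at hi
      exact one_ne_zero (neg_eq_zero.mp (hi.symm.trans (by ring)))
  change IsClosed {s : Gal(Ω/K) | s ^ 2 = 1 ∧ s ≠ 1}
  rw [h]
  exact (isClosed_eq (continuous_pow 2) continuous_const).inter
    ((isLocallyConstant_galois_apply i).isClosed_fiber (-i))

omit [IsGalois K Ω] in
theorem restrictConstants_isInvolution (s : Involutions Gal(Ω/K)) :
    restrictConstants F K k Ω s.1 ^ 2 = 1 ∧ restrictConstants F K k Ω s.1 ≠ 1 := by
  refine ⟨by rw [← map_pow, s.2.1, map_one], fun h1 => ?_⟩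
  obtain ⟨i, hi⟩ := IsAlgClosed.exists_pow_nat_eq (-1 : k) (n := 2) (by norm_num)
  have h2 := s.apply_sqrt_neg_one (i := algebraMap k Ω i) (by rw [← map_pow, hi, map_neg, map_one])
  rw [← algebraMap_restrictConstants (F := F), h1, ← map_neg] at h2
  have : CharZero k := charZero_of_injective_algebraMap (algebraMap F k).injective
  have h3 : i = 0 := self_eq_neg.mp ((algebraMap k Ω).injective h2)
  rw [h3] at hi
  exact one_ne_zero (neg_eq_zero.mp (hi.symm.trans (by ring)))

omit [CharZero F] [IsGalois K Ω] [IsAlgClosed Ω] in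
theorem KummerSystem.map_ζ (κ : KummerSystem k Ω t) {σ : Gal(Ω/K)}
    (hσ : restrictConstants F K k Ω σ ^ 2 = 1 ∧ restrictConstants F K k Ω σ ≠ 1) (n : ℕ+) :
    σ (algebraMap k Ω (κ.ζ n)) = (algebraMap k Ω (κ.ζ n))⁻¹ := by
  rw [← algebraMap_restrictConstants (F := F), ← map_inv₀]
  congr 1
  exact Involutions.apply_root_of_unity ⟨restrictConstants F K k Ω σ, hσ⟩ n.ne_zero
    (κ.isPrimitiveRoot n).pow_eq_one

/-- Since `σ` inverts roots of unity, applying it twice multiplies each root of `t` by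
$\zeta^{-z}\zeta^{z}=1$. -/
theorem IsSeriesValuation.sq_eq_one (h : IsSeriesValuation F t v) (κ : KummerSystem k Ω t)
    {σ : Gal(Ω/K)}
    (hσ : restrictConstants F K k Ω σ ^ 2 = 1 ∧ restrictConstants F K k Ω σ ≠ 1) : σ ^ 2 = 1 := by
  refine h.galois_ext κ (by rw [map_pow, hσ.1, map_one]) fun n => ?_
  obtain ⟨z, hz⟩ := κ.exists_cocycle h.uniformizer_ne_zero σ n
  rw [pow_two, AlgEquiv.mul_apply, hz, map_mul, map_zpow₀, κ.map_ζ hσ, hz, ← mul_assoc, ← mul_zpow,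
    inv_mul_cancel₀ ((κ.map_isPrimitiveRoot n).ne_zero n.ne_zero), one_zpow, one_mul]
  rfl

omit [IsGalois K Ω] in
-- As `s` and `u` both invert $\zeta$, applying `s`, `u`, `s` in turn to $\rho$ gives the exponents
-- $z$, $w-z$, $2z-w$.
theorem IsSeriesValuation.cocycle_act (h : IsSeriesValuation F t v) (κ : KummerSystem k Ω t)
    (s u : Involutions Gal(Ω/K)) : κ.cocycle h.uniformizer_ne_zero (s ◃ u).1 =
      κ.cocycle h.uniformizer_ne_zero s.1 ◃ κ.cocycle h.uniformizer_ne_zero u.1 := by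
  refine zhat_ext fun n => ?_
  obtain ⟨z, hz⟩ := κ.exists_cocycle h.uniformizer_ne_zero s.1 n
  obtain ⟨w, hw⟩ := κ.exists_cocycle h.uniformizer_ne_zero u.1 n
  have h0 := (κ.map_isPrimitiveRoot n).ne_zero n.ne_zero
  have hinv : s.1⁻¹ = s.1 := inv_eq_of_mul_eq_one_left (by rw [← pow_two, s.2.1])
  have hsζ := κ.map_ζ (F := F) (restrictConstants_isInvolution s) n
  have huζ := κ.map_ζ (F := F) (restrictConstants_isInvolution u) n
  have hact : (κ.cocycle h.uniformizer_ne_zero (s ◃ u).1).1 n = ((2 * z - w : ℤ) : ZMod n) := by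
    rw [κ.cocycle_apply_eq_iff]
    change (s.1 * u.1 * s.1⁻¹) (κ.ρ n) = _
    rw [hinv, AlgEquiv.mul_apply, AlgEquiv.mul_apply, hz]
    simp only [map_mul, map_zpow₀, huζ, hsζ, hw, hz, map_inv₀, inv_inv]
    rw [inv_zpow', ← mul_assoc, ← mul_assoc, ← zpow_add₀ h0, ← zpow_add₀ h0]
    congr 2
    ring
  have hs := (κ.cocycle_apply_eq_iff h.uniformizer_ne_zero).mpr hz
  have hu := (κ.cocycle_apply_eq_iff h.uniformizer_ne_zero).mpr hw
  rw [hact, zhat_act]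
  change _ = 2 * (κ.cocycle _ s.1).1 n - (κ.cocycle _ u.1).1 n
  rw [hs, hu]
  push_cast
  rfl

/-- Involutions correspond to involutions of the field of constants together with a pro-finite
integer. -/
theorem IsSeriesValuation.nonempty_quandleHomeo (h : IsSeriesValuation F t v)
    (κ : KummerSystem k Ω t) :
    Nonempty (QuandleHomeo (Involutions Gal(Ω/K)) (Involutions Gal(k/F) × ZHat)) := by
  have : CharZero K := charZero_of_injective_algebraMap (algebraMap F K).injective
  have : CompactSpace (Involutions Gal(Ω/K)) := compactSpace_involutions
  let f (s : Involutions Gal(Ω/K)) : Involutions Gal(k/F) × ZHat :=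
    (⟨restrictConstants F K k Ω s.1, restrictConstants_isInvolution s⟩,
      κ.cocycle h.uniformizer_ne_zero s.1)
  have hf : Continuous f :=
    ((continuous_restrictConstants.comp continuous_subtype_val).subtype_mk _).prodMk
      ((κ.continuous_cocycle h.uniformizer_ne_zero).comp continuous_subtype_val)
  have hinj : Function.Injective f := by
    intro s u hsu
    refine Subtype.ext (h.galois_ext κ (congrArg (fun p => p.1.1) hsu) fun n => ?_)
    obtain ⟨z, hz⟩ := κ.exists_cocycle h.uniformizer_ne_zero s.1 n
    have h1 := (κ.cocycle_apply_eq_iff h.uniformizer_ne_zero).mpr hz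
    rw [show κ.cocycle h.uniformizer_ne_zero s.1 = κ.cocycle h.uniformizer_ne_zero u.1 from
      congrArg Prod.snd hsu, κ.cocycle_apply_eq_iff] at h1
    rw [hz, h1]
  have hsurj : Function.Surjective f := by
    rintro ⟨τ, c⟩
    obtain ⟨σ, hσ, hc⟩ := h.exists_galois κ τ.1 c
    refine ⟨⟨σ, h.sq_eq_one κ (hσ.symm ▸ τ.2), ?_⟩, Prod.ext (Subtype.ext hσ) hc⟩
    rintro rfl
    exact τ.2.2 (by rw [← hσ, map_one])
  let e : Involutions Gal(Ω/K) ≃ₜ Involutions Gal(k/F) × ZHat :=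
    Continuous.homeoOfEquivCompactToT2 (f := Equiv.ofBijective f ⟨hinj, hsurj⟩) hf
  refine ⟨{ toHomeomorph := e, map_act' := fun s u => ?_ }⟩
  refine Prod.ext (Subtype.ext ?_) (h.cocycle_act κ s u)
  change restrictConstants F K k Ω (s.1 * u.1 * s.1⁻¹) = _
  rw [map_mul, map_mul, map_inv]
  rfl

end Main

end ArtinSchreier

namespace ArtinSchreier

open scoped NNReal WithZero

/-! ### The valuation on the algebraic closure of a field of Laurent series -/

/-- The spectral norm on an algebraic extension of a complete field, as a valuation. -/
noncomputable def spectralValuation (K Ω : Type*) [NontriviallyNormedField K] [IsUltrametricDist K]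
    [CompleteSpace K] [Field Ω] [Algebra K Ω] [Algebra.IsAlgebraic K Ω] : Valuation Ω ℝ≥0 where
  toFun x := ⟨spectralNorm K Ω x, spectralNorm_nonneg x⟩
  map_zero' := NNReal.eq spectralNorm_zero
  map_one' := NNReal.eq spectralNorm_one
  map_mul' x y := NNReal.eq (map_mul (spectralMulAlgNorm K Ω) x y)
  map_add_le_max' x y := isNonarchimedean_spectralNorm x y

section Spectral

variable {K Ω : Type*} [NontriviallyNormedField K] [IsUltrametricDist K]
    [CompleteSpace K] [Field Ω] [Algebra K Ω] [Algebra.IsAlgebraic K Ω]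

theorem spectralValuation_algebraMap (y : K) :
    spectralValuation K Ω (algebraMap K Ω y) = ‖y‖₊ :=
  NNReal.eq (spectralNorm_extends y)

theorem spectralValuation_galois (σ : Gal(Ω/K)) (x : Ω) :
    spectralValuation K Ω (σ x) = spectralValuation K Ω x :=
  NNReal.eq (spectralNorm_eq_of_equiv σ x).symm

theorem norm_minpoly_coeff_le_one {x : Ω} (hx : spectralValuation K Ω x ≤ 1) (i : ℕ) :
    ‖(minpoly K x).coeff i‖ ≤ 1 :=
  (spectralValue_le_one_iff (minpoly.monic (Algebra.IsIntegral.isIntegral x))).mp hx i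

end Spectral

/-! ### The $t$-adic valuation on Laurent series -/

section Laurent

variable {F : Type*} [Field F]

theorem valuation_C_le_one (a : F) : Valued.v (HahnSeries.C a : F⸨X⸩) ≤ (1 : ℤᵐ⁰) := by
  have := (LaurentSeries.valuation_le_iff_coeff_lt_eq_zero F (D := 0)
    (f := HahnSeries.C a)).mpr fun n hn => by
      rw [HahnSeries.C_apply, HahnSeries.coeff_single_of_ne hn.ne]
  simpa using this

theorem valuation_C {a : F} (ha : a ≠ 0) : Valued.v (HahnSeries.C a : F⸨X⸩) = (1 : ℤᵐ⁰) := by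
  refine le_antisymm (valuation_C_le_one a) ?_
  have h := valuation_C_le_one a⁻¹
  rw [map_inv₀, map_inv₀] at h
  refine (inv_le_one₀ (zero_lt_iff.mpr ?_)).mp h
  rw [Valuation.ne_zero_iff]
  simpa using ha

theorem valuation_sub_coeff_zero_lt_one {y : F⸨X⸩} (hy : Valued.v y ≤ (1 : ℤᵐ⁰)) :
    Valued.v (y - HahnSeries.C (y.coeff 0)) < (1 : ℤᵐ⁰) := by
  have h0 : Valued.v y ≤ WithZero.exp (-0 : ℤ) := by simpa using hy
  have h1 := (LaurentSeries.valuation_le_iff_coeff_lt_eq_zero F).mp h0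
  have h2 := (LaurentSeries.valuation_le_iff_coeff_lt_eq_zero F (D := 1)
    (f := y - HahnSeries.C (y.coeff 0))).mpr fun n hn => by
      rw [HahnSeries.coeff_sub, HahnSeries.C_apply]
      rcases (Int.lt_add_one_iff.mp hn : n ≤ 0).lt_or_eq with h | rfl
      · rw [h1 n h, HahnSeries.coeff_single_of_ne h.ne, sub_zero]
      · rw [HahnSeries.coeff_single_same, sub_self]
  refine h2.trans_lt ?_
  rw [← WithZero.exp_zero, WithZero.exp_lt_exp]
  norm_num

theorem exists_valuation_eq_single {y : F⸨X⸩} (hy : y ≠ 0) :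
    ∃ z : ℤ, (Valued.v y : ℤᵐ⁰) = Valued.v ((HahnSeries.single 1 1 : F⸨X⸩) ^ z) := by
  refine ⟨-WithZero.log (Valued.v y), ?_⟩
  rw [map_zpow₀, LaurentSeries.valuation_single_zpow, ← WithZero.exp_zsmul, smul_neg, neg_smul,
    neg_neg, smul_eq_mul, mul_one, WithZero.exp_log]
  exact (Valuation.ne_zero_iff _).mpr hy

/-- Rank one turns the integer-valued valuation into a real norm, as the spectral norm requires. -/
theorem nonempty_rankOne_laurentSeries :
    Nonempty (Valued.v : Valuation F⸨X⸩ ℤᵐ⁰).RankOne := by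
  have hnt : (Valued.v : Valuation F⸨X⸩ ℤᵐ⁰).IsNontrivial := ⟨⟨HahnSeries.single 1 1, by
    rw [LaurentSeries.valuation_single_zpow]
    exact ⟨WithZero.exp_ne_zero, by
      rw [← WithZero.exp_zero, Ne, WithZero.exp_inj]
      norm_num⟩⟩⟩
  exact Valuation.nonempty_rankOne_iff_mulArchimedean.mpr
    (MulArchimedean.comap (MonoidWithZeroHom.ValueGroup₀.embedding
      (f := MonoidWithZeroHom.ofClass (Valued.v : Valuation F⸨X⸩ ℤᵐ⁰))).toMonoidHom
      MonoidWithZeroHom.ValueGroup₀.embedding_strictMono)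

/-- Completeness of `F⸨X⸩` makes the spectral norm multiplicative. It depends only on minimal
polynomials, hence is Galois invariant; the remaining properties are read off from Laurent
coefficients. -/
theorem exists_isSeriesValuation {Ω : Type*} [Field Ω] [Algebra F Ω] [Algebra F⸨X⸩ Ω]
    [Algebra.IsAlgebraic F⸨X⸩ Ω]
    (hF : ∀ a : F, algebraMap F Ω a = algebraMap F⸨X⸩ Ω (HahnSeries.C a)) :
    ∃ v : Valuation Ω ℝ≥0, IsSeriesValuation F (HahnSeries.single 1 1 : F⸨X⸩) v := by
  obtain ⟨hr⟩ := nonempty_rankOne_laurentSeries (F := F)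
  let : NontriviallyNormedField F⸨X⸩ := Valued.toNontriviallyNormedField F⸨X⸩ ℤᵐ⁰
  have : IsUltrametricDist F⸨X⸩ := Valued.instIsUltrametricDist F⸨X⸩ ℤᵐ⁰
  have : CompleteSpace F⸨X⸩ := LaurentSeries.instLaurentSeriesComplete
  have hle (x : F⸨X⸩) : ‖x‖₊ ≤ 1 ↔ Valued.v x ≤ (1 : ℤᵐ⁰) := Valued.toNormedField.norm_le_one_iff
  have hlt (x : F⸨X⸩) : ‖x‖₊ < 1 ↔ Valued.v x < (1 : ℤᵐ⁰) := Valued.toNormedField.norm_lt_one_iff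
  have heq {x y : F⸨X⸩} (h : (Valued.v x : ℤᵐ⁰) = Valued.v y) : ‖x‖₊ = ‖y‖₊ :=
    le_antisymm (Valued.toNormedField.norm_le_iff.mpr h.le)
      (Valued.toNormedField.norm_le_iff.mpr h.ge)
  refine ⟨spectralValuation F⸨X⸩ Ω, ⟨spectralValuation_galois, fun a ha => ?_, ?_, ?_,
    fun y hy => ?_, fun y hy => ?_, fun x hx i => ?_⟩⟩
  · rw [hF, spectralValuation_algebraMap, heq ((valuation_C ha).trans (map_one _).symm), nnnorm_one]
  · simp
  · rw [spectralValuation_algebraMap, hlt, LaurentSeries.valuation_single_zpow,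
      ← WithZero.exp_zero, WithZero.exp_lt_exp]
    norm_num
  · obtain ⟨z, hz⟩ := exists_valuation_eq_single hy
    exact ⟨z, by rw [← map_zpow₀, ← map_zpow₀, spectralValuation_algebraMap,
      spectralValuation_algebraMap, heq hz]⟩
  · rw [spectralValuation_algebraMap, hle] at hy
    exact ⟨y.coeff 0, by
      rw [hF, ← map_sub, spectralValuation_algebraMap, hlt]
      exact valuation_sub_coeff_zero_lt_one hy⟩
  · rw [spectralValuation_algebraMap]
    exact norm_minpoly_coeff_le_one hx i

end Laurent

/-! ### The Artin–Schreier quandle of a field of Laurent series -/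

theorem charZero_of_nonempty_AS {F : Type u} [Field F] (s : AS F) : CharZero F :=
  have : CharZero (AlgebraicClosure F) :=
    Involutions.charZero (K := F) (Ω := AlgebraicClosure F) s
  (algebraMap F (AlgebraicClosure F)).charZero_iff (algebraMap F _).injective |>.mpr this

theorem IsSeriesValuation.nonempty_quandleHomeo_algClosure {F K k Ω : Type*} [Field F] [Field K]
    [Field k] [Field Ω] [CharZero F] [Algebra F K] [Algebra F Ω] [Algebra K Ω]
    [IsScalarTower F K Ω] [Algebra F k] [IsAlgClosure F k] [IsAlgClosure K Ω] {t : K} {v : Valuation Ω ℝ≥0}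
    (hv : IsSeriesValuation F t v) :
    Nonempty (QuandleHomeo (Involutions Gal(Ω/K)) (Involutions Gal(k/F) × ZHat)) := by
  have : IsAlgClosed k := IsAlgClosure.isAlgClosed F
  have : IsAlgClosed Ω := IsAlgClosure.isAlgClosed K
  have : Algebra.IsAlgebraic F k := IsAlgClosure.isAlgebraic
  have : Algebra.IsAlgebraic K Ω := IsAlgClosure.isAlgebraic
  have : CharZero K := charZero_of_injective_algebraMap (algebraMap F K).injective
  have : CharZero Ω := charZero_of_injective_algebraMap (algebraMap K Ω).injective
  have : CharZero k := charZero_of_injective_algebraMap (algebraMap F k).injective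
  -- Any embedding over `F` will do to view `k` as the field of constants of `Ω`.
  have j : k →ₐ[F] Ω := IsAlgClosed.lift
  let : Algebra k Ω := j.toRingHom.toAlgebra
  have : IsScalarTower F k Ω := IsScalarTower.of_algebraMap_eq fun x => (j.commutes x).symm
  have : IsGalois F k := IsAlgClosure.isGalois F k
  have : IsGalois K Ω := IsAlgClosure.isGalois K Ω
  obtain ⟨ζ, hζ, hζ'⟩ := exists_compatible_roots_of_unity k
  obtain ⟨ρ, hρ, hρ'⟩ := exists_compatible_roots (algebraMap K Ω t)
  exact hv.nonempty_quandleHomeo (K := K) (k := k) ⟨ζ, ρ, hζ, hζ', hρ, hρ'⟩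

theorem nonempty_quandleHomeo_AS_laurentSeries (F : Type u) [Field F] [CharZero F] :
    Nonempty (QuandleHomeo (AS F⸨X⸩) (AS F × ZHat)) := by
  let A : Algebra F F⸨X⸩ := (HahnSeries.C : F →+* F⸨X⸩).toAlgebra
  let B : Algebra F (AlgebraicClosure F⸨X⸩) :=
    ((algebraMap F⸨X⸩ (AlgebraicClosure F⸨X⸩)).comp (HahnSeries.C : F →+* F⸨X⸩)).toAlgebra
  have hT : @IsScalarTower F F⸨X⸩ (AlgebraicClosure F⸨X⸩) A.toSMul Algebra.toSMul B.toSMul :=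
    @IsScalarTower.of_algebraMap_eq F F⸨X⸩ (AlgebraicClosure F⸨X⸩) _ _ _ A _ B fun _ => rfl
  obtain ⟨v, hv⟩ := exists_isSeriesValuation (F := F) (Ω := AlgebraicClosure F⸨X⸩) fun _ => rfl
  exact IsSeriesValuation.nonempty_quandleHomeo_algClosure (k := AlgebraicClosure F) hv

theorem QuandleHomeo.nonempty_prod_symm_trans {A : Type u} {B : Type v} {C Z : Type w} [Quandle A]
    [Quandle B] [Quandle C] [Quandle Z] [TopologicalSpace A] [TopologicalSpace B]
    [TopologicalSpace C] [TopologicalSpace Z] (e : QuandleHomeo A (B × Z)) (f : QuandleHomeo C Z) :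
    Nonempty (QuandleHomeo A (B × C)) :=
  ⟨{ toHomeomorph :=
      e.toHomeomorph.trans ((Homeomorph.refl B).prodCongr f.symm.toHomeomorph)
     map_act' := fun x y => by
      change ((e.toFun (x ◃ y)).1, f.symm.toFun (e.toFun (x ◃ y)).2) = _
      rw [e.map_act']
      exact Prod.ext rfl (f.symm.map_act' _ _) }⟩

end ArtinSchreier

theorem theorem5p1 (F : Type u) [Field F] :
    Nonempty (QuandleHomeo (AS F⸨X⸩) (AS F × FQ2hat (Fin 2))) ∧
    IsFreeProfiniteInvolutory.{0, v, 0} (FQ2hat.of : Fin 2 → FQ2hat (Fin 2)) ∧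
    Nonempty (QuandleHomeo (FQ2hat (Fin 2)) ZHat) := by
  refine ⟨?_, FQ2hat.isFreeProfiniteInvolutory, ⟨FQ2hat.quandleHomeoZHat⟩⟩
  by_cases hF : CharZero F
  · obtain ⟨e⟩ := nonempty_quandleHomeo_AS_laurentSeries F
    exact e.nonempty_prod_symm_trans FQ2hat.quandleHomeoZHat
  -- An involution on either side would force characteristic 0, so both quandles are empty.
  · have h1 : IsEmpty (AS F) := ⟨fun s => hF (charZero_of_nonempty_AS s)⟩
    have h2 : IsEmpty (AS F⸨X⸩) := ⟨fun s => hF (by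
      have := charZero_of_nonempty_AS s
      exact (HahnSeries.C : F →+* F⸨X⸩).charZero_iff (HahnSeries.C : F →+* F⸨X⸩).injective
        |>.mpr this)⟩
    exact ⟨{ toHomeomorph := Homeomorph.empty, map_act' := fun x => isEmptyElim x }⟩
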